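/- Conventions. All functions are complex valued. For $f\in L_2(\mathbb R^2)$ let $\operatorname{Op}(f)$ be the integral operator on $L_2(\mathbb R)$ given by $\operatorname{Op}(f)g(y)=\int_{\mathbb R} f(x,y)g(x)\,dx$. For a bounded operator $T$ on a Hilbert space and $0<p<\infty$ let $\mu(n,T)=\inf\{\|T-R\| : \operatorname{rank} R\le n\}$ and $\|T\|_p=\big(\sum_{n\ge 0}\mu(n,T)^p\big)^{1/p}\in[0,\infty]$. For $k\in L_\infty(\mathbb R^2)$ put $$\|k\|_{\mathfrak M_p}=\sup\{\|\operatorname{Op}(kf)\|_p : f\in L_2(\mathbb R^2),\ \|\operatorname{Op}(f)\|_p\le 1\}\in[0,\infty].$$ For $0<p<2$ let $p^\flat=\frac{2p}{2-p}$. A function $\varphi$ on $\mathbb R$ is an orthonormal wavelet if the functions $\varphi_{j,l}(t)=2^{j/2}\varphi(2^jt-l)$, $j,l\in\mathbb Z$, form an orthonormal basis of $L_2(\mathbb R)$. Statement. Let $\varphi$ be a compactly supported, essentially bounded orthonormal wavelet (for example, any compactly supported $C^N$ wavelet, $N\ge 0$). There is a finite constant $C$, depending only on $\varphi$, such that the following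 holds for every $0<p<2$, every $k\in L_\infty(\mathbb R^2)$ and every $j\in\mathbb Z$. Put $$k_{j,l}(s)=\int_{\mathbb R}\varphi_{j,l}(t)\,k(t,s)\,dt\quad(l\in\mathbb Z),\qquad k_j(t,s)=\sum_{l\in\mathbb Z}\varphi_{j,l}(t)\,k_{j,l}(s).$$ Then $k_j\in L_\infty(\mathbb R^2)$ and $$\|k_j\|_{\mathfrak M_p}\le C\,2^{j/2}\,\Big(\sum_{l\in\mathbb Z}\|k_{j,l}\|_\infty^{p^\flat}\Big)^{1/p^\flat},$$ where the right-hand side may be $+\infty$. In particular this holds for every bounded $k\in\dot B^{1/p^\flat}_{p^\flat,p}(\mathbb R,L_\infty(\mathbb R))$. -/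

import Mathlib

open MeasureTheory
open scoped ENNReal NNReal

noncomputable section

/-! ### Integral operators with square-integrable kernel -/

/-- Almost every slice `x ↦ f (x, y)` of a square-integrable function of two variables is
square-integrable. -/
lemma SchurWavelet.memLp_slice {f : ℝ × ℝ → ℂ} (hf : MemLp f 2 volume) :
    ∀ᵐ y : ℝ, MemLp (fun x : ℝ => f (x, y)) 2 volume := by
  have hs : MemLp (fun z : ℝ × ℝ => f z.swap) 2 (volume.prod volume) :=
    hf.comp_measurePreserving (Measure.measurePreserving_swap (μ := volume) (ν := volume))
  have h1 := hs.1.prodMk_left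
  have h2 : ∫⁻ z : ℝ × ℝ, ‖f z.swap‖ₑ ^ (2 : ℝ) ∂(volume.prod volume) < ∞ := by
    simpa using lintegral_rpow_enorm_lt_top_of_eLpNorm_lt_top two_ne_zero ENNReal.ofNat_ne_top hs.2
  have hm : AEMeasurable (fun z : ℝ × ℝ => ‖f z.swap‖ₑ ^ (2 : ℝ)) (volume.prod volume) :=
    hs.1.enorm.pow_const _
  rw [lintegral_prod _ hm] at h2
  have h3 := ae_lt_top' hm.lintegral_prod_right' h2.ne
  filter_upwards [h1, h3] with y hy1 hy3
  refine ⟨hy1, ?_⟩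
  rw [eLpNorm_lt_top_iff_lintegral_rpow_enorm_lt_top two_ne_zero ENNReal.ofNat_ne_top]
  simpa using hy3

/-- The Cauchy--Schwarz bound for integral operators, together with measurability of the image. -/
lemma SchurWavelet.memLp_integral {f : ℝ × ℝ → ℂ} (hf : MemLp f 2 volume) {g : ℝ → ℂ}
    (hg : MemLp g 2 volume) :
    MemLp (fun y : ℝ => ∫ x : ℝ, f (x, y) * g x) 2 volume ∧
      eLpNorm (fun y : ℝ => ∫ x : ℝ, f (x, y) * g x) 2 volume
        ≤ eLpNorm f 2 volume * eLpNorm g 2 volume := by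
  have hmp : MeasurePreserving (Prod.swap : ℝ × ℝ → ℝ × ℝ) (volume.prod volume)
      (volume.prod volume) := Measure.measurePreserving_swap
  have hs : MemLp (fun z : ℝ × ℝ => f z.swap) 2 (volume.prod volume) :=
    hf.comp_measurePreserving hmp
  have hnorm : eLpNorm (fun z : ℝ × ℝ => f z.swap) 2 (volume.prod volume) = eLpNorm f 2 volume :=
    eLpNorm_comp_measurePreserving hf.1 hmp
  have hmeas : AEStronglyMeasurable (fun y : ℝ => ∫ x : ℝ, f (x, y) * g x) volume := by
    have : AEStronglyMeasurable (fun z : ℝ × ℝ => f z.swap * g z.2) (volume.prod volume) :=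
      hs.1.mul hg.1.comp_snd
    exact this.integral_prod_right'
  have hm : AEMeasurable (fun z : ℝ × ℝ => ‖f z.swap‖ₑ ^ (2 : ℝ)) (volume.prod volume) :=
    hs.1.enorm.pow_const _
  have hbound : eLpNorm (fun y : ℝ => ∫ x : ℝ, f (x, y) * g x) 2 volume
      ≤ eLpNorm f 2 volume * eLpNorm g 2 volume := by
    rw [← hnorm]
    simp only [eLpNorm_eq_lintegral_rpow_enorm_toReal two_ne_zero ENNReal.ofNat_ne_top,
      ENNReal.toReal_ofNat]
    rw [← ENNReal.mul_rpow_of_nonneg _ _ (by norm_num : (0 : ℝ) ≤ 1 / 2)]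
    refine ENNReal.rpow_le_rpow ?_ (by norm_num)
    rw [lintegral_prod _ hm, ← lintegral_mul_const'' _ hm.lintegral_prod_right']
    refine lintegral_mono_ae ?_
    filter_upwards [SchurWavelet.memLp_slice hf] with y hy
    have h1 : ‖∫ x : ℝ, f (x, y) * g x‖ₑ ≤ ∫⁻ x : ℝ, ‖f (x, y)‖ₑ * ‖g x‖ₑ := by
      refine (enorm_integral_le_lintegral_enorm _).trans (le_of_eq ?_)
      simp only [enorm_mul]
    have h2 : ∫⁻ x : ℝ, ‖f (x, y)‖ₑ * ‖g x‖ₑ ≤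
        (∫⁻ x : ℝ, ‖f (x, y)‖ₑ ^ (2 : ℝ)) ^ (1 / 2 : ℝ) *
          (∫⁻ x : ℝ, ‖g x‖ₑ ^ (2 : ℝ)) ^ (1 / 2 : ℝ) :=
      ENNReal.lintegral_mul_le_Lp_mul_Lq volume (Real.holderConjugate_iff.2 (by norm_num))
        hy.1.enorm hg.1.enorm
    calc ‖∫ x : ℝ, f (x, y) * g x‖ₑ ^ (2 : ℝ)
        ≤ ((∫⁻ x : ℝ, ‖f (x, y)‖ₑ ^ (2 : ℝ)) ^ (1 / 2 : ℝ) *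
          (∫⁻ x : ℝ, ‖g x‖ₑ ^ (2 : ℝ)) ^ (1 / 2 : ℝ)) ^ (2 : ℝ) :=
          ENNReal.rpow_le_rpow (h1.trans h2) (by norm_num)
      _ = _ := by
          rw [← ENNReal.mul_rpow_of_nonneg _ _ (by norm_num : (0 : ℝ) ≤ 1 / 2),
            ← ENNReal.rpow_mul]
          norm_num
  exact ⟨⟨hmeas, hbound.trans_lt (ENNReal.mul_lt_top hf.2 hg.2)⟩, hbound⟩

/-- The integral operator `Op(f)` on `L₂(ℝ)` with kernel `f ∈ L₂(ℝ²)`,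
`Op(f) g (y) = ∫ f(x, y) g(x) dx`. -/
def SchurWavelet.integralOp (f : ℝ × ℝ → ℂ) (hf : MemLp f 2 volume) :
    Lp ℂ 2 (volume : Measure ℝ) →L[ℂ] Lp ℂ 2 (volume : Measure ℝ) :=
  LinearMap.mkContinuous
    { toFun := fun g =>
        (SchurWavelet.memLp_integral hf (Lp.memLp g)).1.toLp
          (fun y : ℝ => ∫ x : ℝ, f (x, y) * g x)
      map_add' := by
        intro g h
        rw [← MemLp.toLp_add, MemLp.toLp_eq_toLp_iff]
        filter_upwards [SchurWavelet.memLp_slice hf] with y hy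
        have hg : Integrable (fun x => f (x, y) * g x) volume := hy.integrable_mul (Lp.memLp g)
        have hh : Integrable (fun x => f (x, y) * h x) volume := hy.integrable_mul (Lp.memLp h)
        rw [Pi.add_apply, ← integral_add hg hh]
        refine integral_congr_ae ?_
        filter_upwards [Lp.coeFn_add g h] with x hx
        rw [hx]
        simp [mul_add]
      map_smul' := by
        intro c g
        rw [RingHom.id_apply, ← MemLp.toLp_const_smul, MemLp.toLp_eq_toLp_iff]
        refine Filter.Eventually.of_forall fun y => ?_
        rw [Pi.smul_apply, ← integral_smul]
        refine integral_congr_ae ?_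
        filter_upwards [Lp.coeFn_smul c g] with x hx
        rw [hx]
        simp only [Pi.smul_apply, smul_eq_mul]
        ring }
    (eLpNorm f 2 volume).toReal
    (by
      intro g
      simp only [LinearMap.coe_mk, AddHom.coe_mk, Lp.norm_def]
      rw [← ENNReal.toReal_mul, eLpNorm_congr_ae (MemLp.coeFn_toLp _)]
      exact ENNReal.toReal_mono (ENNReal.mul_ne_top hf.2.ne (Lp.memLp g).2.ne)
        (SchurWavelet.memLp_integral hf (Lp.memLp g)).2)

/-! ### Singular values and Schatten--von Neumann quasi-norms -/

/-- The `n`-th singular value `μ(n, T) = inf {‖T - R‖ : rank R ≤ n}`. -/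
def SchurWavelet.singularValue {H : Type*} [NormedAddCommGroup H] [InnerProductSpace ℂ H]
    (n : ℕ) (T : H →L[ℂ] H) : ℝ≥0∞ :=
  ⨅ (R : H →L[ℂ] H) (_ : (R : H →ₗ[ℂ] H).rank ≤ n), ‖T - R‖ₑ

/-- The quasi-norm `‖T‖_p = (∑ₙ μ(n, T)^p)^{1/p}` for `0 < p < ∞`; it is `∞` exactly when `T` is
not in the Schatten--von Neumann class. -/
def SchurWavelet.schattenNorm {H : Type*} [NormedAddCommGroup H] [InnerProductSpace ℂ H]
    (p : ℝ) (T : H →L[ℂ] H) : ℝ≥0∞ :=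
  (∑' n : ℕ, SchurWavelet.singularValue n T ^ p) ^ (1 / p)

/-! ### Schur multipliers -/

/-- The quasi-norm `‖k‖_{𝔐_p} = sup {‖Op(k f)‖_p : f ∈ L₂(ℝ²), ‖Op(f)‖_p ≤ 1}` of
`k ∈ L_∞(ℝ²)`; it is `∞` exactly when `k` is not an `𝓛_p`-Schur multiplier. -/
def SchurWavelet.multiplierNorm (p : ℝ) (k : ℝ × ℝ → ℂ) (hk : MemLp k ∞ volume) : ℝ≥0∞ :=
  ⨆ (f : ℝ × ℝ → ℂ) (hf : MemLp f 2 volume)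
    (_ : SchurWavelet.schattenNorm p (SchurWavelet.integralOp f hf) ≤ 1),
    SchurWavelet.schattenNorm p
      (SchurWavelet.integralOp (fun z => k z * f z) (hf.mul' hk))

/-! ### Wavelets -/

/-- `φ_{j,l}(t) = 2^{j/2} φ(2^j t - l)`. -/
def SchurWavelet.waveletFun (φ : ℝ → ℂ) (j l : ℤ) (t : ℝ) : ℂ :=
  (((2 : ℝ) ^ ((j : ℝ) / 2) : ℝ) : ℂ) * φ ((2 : ℝ) ^ j * t - l)

/-- `φ` is an orthonormal wavelet, that is, the wavelet system `(φ_{j,l})_{j,l ∈ ℤ}` is an orthonormal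
(Hilbert) basis of `L₂(ℝ)`. -/
def SchurWavelet.IsOrthonormalWavelet (φ : ℝ → ℂ) : Prop :=
  ∃ b : HilbertBasis (ℤ × ℤ) ℂ (Lp ℂ 2 (volume : Measure ℝ)),
    ∀ j l : ℤ, (b (j, l) : ℝ → ℂ) =ᵐ[volume] SchurWavelet.waveletFun φ j l

/-- The wavelet coefficient function `k_{j,l}(s) = ∫ φ_{j,l}(t) k(t, s) dt`. -/
def SchurWavelet.waveletCoeff (φ : ℝ → ℂ) (k : ℝ × ℝ → ℂ) (j l : ℤ) (s : ℝ) : ℂ :=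
  ∫ t : ℝ, SchurWavelet.waveletFun φ j l t * k (t, s)

/-- The scale-`j` part `k_j(t, s) = ∑_l φ_{j,l}(t) k_{j,l}(s)`. (For compactly supported `φ` the
sum has only finitely many nonzero terms at each point.) -/
def SchurWavelet.scalePart (φ : ℝ → ℂ) (k : ℝ × ℝ → ℂ) (j : ℤ) (z : ℝ × ℝ) : ℂ :=
  ∑' l : ℤ, SchurWavelet.waveletFun φ j l z.1 * SchurWavelet.waveletCoeff φ k j l z.2

/-- The exponent `p^♭ = 2p / (2 - p)`, for `0 < p < 2`. -/
def SchurWavelet.flat (p : ℝ) : ℝ := 2 * p / (2 - p)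

/-- The `ℓ_q(ℤ)` quasi-norm of a sequence of nonnegative extended reals, `0 < q < ∞`. -/
def SchurWavelet.ellNorm (q : ℝ) (a : ℤ → ℝ≥0∞) : ℝ≥0∞ :=
  (∑' l : ℤ, a l ^ q) ^ (1 / q)

end

/-!
The kernel `k_j` is a sum of elementary tensors `∑ₗ aₗ(t) bₗ(s)`, where `aₗ = φ_{j,l}` and
`bₗ = k_{j,l}`. As `φ` is bounded with compact support, a bounded number of its integer translates
meet at any point, so `∑ₗ |aₗ(t)| ≤ 2^{j/2} W` almost everywhere, with `W` depending only on `φ`.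

Write `aₗ = uₗ vₗ` with `|uₗ|² = |vₗ|² = |aₗ|`. Then `Op(k_j f) = ∑ₗ M_{bₗ} Op(f) M_{uₗ} M_{vₗ}`,
where both `∑ₗ |uₗ|²` and `∑ₗ |vₗ|²` are at most `2^{j/2} W`. If `∑ₗ ‖Φₗ x‖² ≤ B ‖x‖²` and
`T = ∑ₗ Xₗ Φₗ`, then `‖T* y‖² ≤ B ∑ₗ ‖Xₗ* y‖²`; comparing the quadratic forms `‖T* y‖²` and
`‖Xₗ* y‖²` in eigenbases and using `p ≤ 2` gives `‖T‖_p^p ≤ B^{p/2} ∑ₗ ‖Xₗ‖_p^p`. For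
`Xₗ = M_{bₗ} Op(f) M_{uₗ}`, evaluating on an eigenbasis of `Op(f) Op(f)*` and applying Hölder with
the weights `1 - p/2` and `p/2` produces the `ℓ_{p^♭}` norm of `(‖bₗ‖_∞)ₗ`. The infinite sum is
reached from the finite ones by lower semicontinuity of the Schatten quasi-norm.
-/

open Filter Topology
open scoped InnerProductSpace
open ContinuousLinearMap (adjoint)

namespace SchurWavelet

section ENNRealSeries

variable {ι α : Type*}

theorem tsum_le_tsum_of_iInf_le {a : ι → ℝ≥0∞} {b : ℕ → ℝ≥0∞}
    (h : ∀ (F : Finset ι) (n : ℕ), F.card = n + 1 → ⨅ i ∈ F, a i ≤ b n) :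
    ∑' i, a i ≤ ∑' n, b n := by
  classical
  have sum_le : ∀ (n : ℕ) (F : Finset ι), F.card = n →
      ∑ i ∈ F, a i ≤ ∑ m ∈ Finset.range n, b m := by
    intro n
    induction n with
    | zero => intro F hF; simp [Finset.card_eq_zero.1 hF]
    | succ n ih =>
      intro F hF
      obtain ⟨i, hi, hmin⟩ := F.exists_min_image a (Finset.card_pos.1 (by omega))
      rw [← Finset.sum_erase_add _ _ hi, Finset.sum_range_succ]
      exact add_le_add (ih _ (by rw [Finset.card_erase_of_mem hi]; omega))
        ((le_iInf₂ hmin).trans (h F n hF))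
  rw [ENNReal.tsum_eq_iSup_sum]
  exact iSup_le fun F => (sum_le _ F rfl).trans (ENNReal.sum_le_tsum _)

theorem exists_finset_mul_sum_range_le {a : ι → ℝ≥0∞} {b : ℕ → ℝ≥0∞}
    (h : ∀ (F : Finset ι) (n : ℕ), F.card ≤ n → b n ≤ ⨆ i ∉ F, a i) (hb : ∀ n, b n ≠ ∞)
    {θ : ℝ≥0∞} (hθ : θ < 1) (n : ℕ) :
    ∃ F : Finset ι, F.card ≤ n ∧ θ * ∑ m ∈ Finset.range n, b m ≤ ∑ i ∈ F, a i := by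
  classical
  induction n with
  | zero => exact ⟨∅, by simp⟩
  | succ n ih =>
    obtain ⟨F, hF, hle⟩ := ih
    rw [Finset.sum_range_succ, mul_add]
    rcases eq_or_ne (b n) 0 with h0 | h0
    · exact ⟨F, hF.trans n.le_succ, by simpa [h0] using hle⟩
    · have hlt : θ * b n < ⨆ i ∉ F, a i :=
        (by simpa using ENNReal.mul_lt_mul_left h0 (hb n) hθ : θ * b n < b n).trans_le (h F n hF)
      simp only [lt_iSup_iff] at hlt
      obtain ⟨i, hi, hlt⟩ := hlt
      refine ⟨insert i F, (Finset.card_insert_le _ _).trans (by omega), ?_⟩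
      rw [Finset.sum_insert hi, add_comm]
      exact add_le_add hlt.le hle

theorem tsum_le_tsum_of_le_iSup {a : ι → ℝ≥0∞} {b : ℕ → ℝ≥0∞}
    (h : ∀ (F : Finset ι) (n : ℕ), F.card ≤ n → b n ≤ ⨆ i ∉ F, a i) :
    ∑' n, b n ≤ ∑' i, a i := by
  rcases eq_or_ne (∑' i, a i) ∞ with htop | hfin
  · simp [htop]
  have hb : ∀ n, b n ≠ ∞ := fun n =>
    ne_top_of_le_ne_top hfin <| (h ∅ n (by simp)).trans <|
      iSup₂_le fun i _ => ENNReal.le_tsum i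
  rw [ENNReal.tsum_eq_iSup_nat]
  refine iSup_le fun n => ENNReal.le_of_forall_lt_one_mul_le fun θ hθ => ?_
  obtain ⟨F, -, hF⟩ := exists_finset_mul_sum_range_le h hb hθ n
  exact hF.trans (ENNReal.sum_le_tsum F)

theorem tsum_rpow_mul_rpow_le (f g : ι → ℝ≥0∞) {q r : ℝ} (hq : 0 ≤ q) (hr : 0 ≤ r)
    (hqr : q + r = 1) :
    ∑' i, f i ^ q * g i ^ r ≤ (∑' i, f i) ^ q * (∑' i, g i) ^ r := by
  let _ : MeasurableSpace ι := ⊤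
  have := ENNReal.lintegral_mul_norm_pow_le (μ := Measure.count) (f := f) (g := g)
    measurable_from_top.aemeasurable measurable_from_top.aemeasurable hq hr hqr
  simpa [lintegral_count] using this

theorem tsum_tsum_rpow_le (x : α → ι → ℝ≥0∞) {c : ι → ℝ≥0∞} (hc : ∀ i, ∑' a, x a i = c i)
    (hfin : ∀ i, c i ≠ ∞) (hle : ∀ a, ∑' i, x a i / c i ≤ 1) {q : ℝ} (hq : 0 < q) (hq1 : q ≤ 1) :
    ∑' i, c i ^ q ≤ ∑' a, (∑' i, x a i) ^ q := by
  have hq' : 0 ≤ 1 - q := sub_nonneg.2 hq1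
  have split : ∀ i, c i ^ q = ∑' a, x a i ^ q * (x a i / c i) ^ (1 - q) := by
    intro i
    rcases eq_or_ne (c i) 0 with h0 | h0
    · have hx : ∀ a, x a i = 0 := ENNReal.tsum_eq_zero.1 ((hc i).trans h0)
      simp [h0, hx, hq]
    · have hterm : ∀ a, x a i ^ q * (x a i / c i) ^ (1 - q) = x a i * (c i ^ (1 - q))⁻¹ := by
        intro a
        rw [ENNReal.div_rpow_of_nonneg _ _ hq', div_eq_mul_inv, ← mul_assoc,
          ← ENNReal.rpow_add_of_nonneg _ _ hq.le hq', add_sub_cancel, ENNReal.rpow_one]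
      rw [tsum_congr hterm, ENNReal.tsum_mul_right, hc, ← div_eq_mul_inv,
        ENNReal.eq_div_iff (by simp [h0, hfin]) (by simp [h0, hfin]),
        ← ENNReal.rpow_add _ _ h0 (hfin i), sub_add_cancel, ENNReal.rpow_one]
  calc ∑' i, c i ^ q = ∑' a, ∑' i, x a i ^ q * (x a i / c i) ^ (1 - q) := by
        rw [tsum_congr split, ENNReal.tsum_comm]
    _ ≤ ∑' a, (∑' i, x a i) ^ q * (∑' i, x a i / c i) ^ (1 - q) :=
        ENNReal.tsum_le_tsum fun a => tsum_rpow_mul_rpow_le _ _ hq.le hq' (by ring)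
    _ ≤ ∑' a, (∑' i, x a i) ^ q := ENNReal.tsum_le_tsum fun a =>
        mul_le_of_le_one_right' (ENNReal.rpow_le_one (hle a) hq')

end ENNRealSeries

section DiagForm

universe v u

variable {𝕜 : Type v} {ι α σ : Type*} {H : Type u} [RCLike 𝕜] [NormedAddCommGroup H]
  [InnerProductSpace 𝕜 H]

theorem tsum_enorm_inner_sq (w : HilbertBasis ι 𝕜 H) (y : H) :
    ∑' i, ‖⟪w i, y⟫_𝕜‖ₑ ^ 2 = ‖y‖ₑ ^ 2 := by
  have hsum : HasSum (fun i => ‖⟪w i, y⟫_𝕜‖ ^ 2) (‖y‖ ^ 2) := by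
    simpa [w.repr_apply_apply] using lp.hasSum_norm (p := 2) (by norm_num) (w.repr y)
  have h := ENNReal.ofReal_tsum_of_nonneg (fun i => sq_nonneg ‖⟪w i, y⟫_𝕜‖) hsum.summable
  rw [hsum.tsum_eq] at h
  simpa [ENNReal.ofReal_pow, ofReal_norm] using h.symm

/-- The nonnegative quadratic form `y ↦ ∑ᵢ cᵢ |⟪wᵢ, y⟫|²` with eigenvalues `c` in the Hilbert basis
`w`. Taking values in `ℝ≥0∞`, it makes sense without boundedness of `c`. -/
noncomputable def diagForm (w : HilbertBasis ι 𝕜 H) (c : ι → ℝ≥0) (y : H) : ℝ≥0∞ :=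
  ∑' i, c i * ‖⟪w i, y⟫_𝕜‖ₑ ^ 2

theorem diagForm_sum_smul (w : HilbertBasis ι 𝕜 H) (c : ι → ℝ≥0) (F : Finset ι) (l : ι → 𝕜) :
    diagForm w c (∑ i ∈ F, l i • w i) = ∑ i ∈ F, c i * ‖l i‖ₑ ^ 2 := by
  classical
  rw [diagForm, tsum_eq_sum (s := F)]
  · exact Finset.sum_congr rfl fun i hi => by rw [w.orthonormal.inner_right_sum l hi]
  · intro i hi
    have hortho : ⟪w i, ∑ m ∈ F, l m • w m⟫_𝕜 = 0 := by
      rw [inner_sum]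
      refine Finset.sum_eq_zero fun m hm => ?_
      rw [inner_smul_right, w.orthonormal.2 (ne_of_mem_of_not_mem hm hi).symm, mul_zero]
    simp [hortho]

theorem diagForm_apply_self (w : HilbertBasis ι 𝕜 H) (c : ι → ℝ≥0) (i : ι) :
    diagForm w c (w i) = c i := by
  simpa using diagForm_sum_smul w c {i} fun _ => 1

theorem exists_hilbertBasis_eigenvectors [CompleteSpace H] {K : H →L[𝕜] H}
    (hK : (K : H →ₗ[𝕜] H).IsSymmetric) (hc : IsCompactOperator K) :
    ∃ (ι : Type (max v u)) (w : HilbertBasis ι 𝕜 H) (μ : ι → 𝕜), ∀ i, K (w i) = μ i • w i := by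
  let V : 𝕜 → Submodule 𝕜 H := fun μ => Module.End.eigenspace (K : H →ₗ[𝕜] H) μ
  have mem_V : ∀ {μ x}, x ∈ V μ ↔ K x = μ • x := Module.End.mem_eigenspace_iff
  have : ∀ μ, CompleteSpace (V μ) := fun μ => by
    have hclosed : IsClosed {x | K x = μ • x} :=
      isClosed_eq K.continuous (continuous_const_smul μ)
    have hV : (V μ : Set H) = {x | K x = μ • x} := Set.ext fun _ => mem_V
    exact (hV ▸ hclosed).completeSpace_coe
  choose s b _ using fun μ => exists_hilbertBasis 𝕜 (V μ)
  let v : (Σ μ, s μ) → H := fun a => b a.1 a.2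
  have orthonormal_v : Orthonormal 𝕜 v :=
    hK.orthogonalFamily_eigenspaces.orthonormal_sigma_orthonormal
      (v_family := fun μ i => b μ i) fun μ => (b μ).orthonormal
  have span_v : (Submodule.span 𝕜 (Set.range v))ᗮ = ⊥ := by
    rw [eq_bot_iff, ← ContinuousLinearMap.orthogonalComplement_iSup_eigenspaces_eq_bot hc hK,
      ← Submodule.iInf_orthogonal]
    refine le_iInf fun μ x hx => ?_
    rw [← Submodule.orthogonalProjectionOnto_eq_zero_iff]
    apply (b μ).repr.injective
    ext i
    rw [map_zero, HilbertBasis.repr_apply_apply,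
      Submodule.inner_orthogonalProjectionOnto_eq_of_mem_left]
    exact (Submodule.mem_orthogonal _ _).1 hx _ (Submodule.subset_span ⟨⟨μ, i⟩, rfl⟩)
  refine ⟨_, HilbertBasis.mkOfOrthogonalEqBot orthonormal_v span_v, fun a => a.1, fun a => ?_⟩
  rw [HilbertBasis.coe_mkOfOrthogonalEqBot]
  exact mem_V.1 (b a.1 a.2).2

theorem exists_sum_enorm_sq_eq_diagForm {G : Type*} [NormedAddCommGroup G] [InnerProductSpace 𝕜 G]
    [CompleteSpace H] [CompleteSpace G] (L : Finset σ) (D : σ → H →L[𝕜] G)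
    (hD : ∀ l ∈ L, IsCompactOperator (D l)) :
    ∃ (ι : Type (max v u)) (w : HilbertBasis ι 𝕜 H) (c : ι → ℝ≥0),
      ∀ y, ∑ l ∈ L, ‖D l y‖ₑ ^ 2 = diagForm w c y := by
  let K : H →L[𝕜] H := ∑ l ∈ L, adjoint (D l) ∘L D l
  have inner_K : ∀ x y, ⟪K x, y⟫_𝕜 = ∑ l ∈ L, ⟪D l x, D l y⟫_𝕜 := fun x y => by
    simp [K, sum_inner, ContinuousLinearMap.adjoint_inner_left]
  have hsymm : (K : H →ₗ[𝕜] H).IsSymmetric := ContinuousLinearMap.IsPositive.isSymmetric <|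
    ContinuousLinearMap.isPositive_sum _ fun l _ =>
      ContinuousLinearMap.isPositive_adjoint_comp_self (D l)
  have hcompact : IsCompactOperator K :=
    (compactOperator (RingHom.id 𝕜) H H).sum_mem fun l hl => by
      exact (hD l hl).clm_comp (adjoint (D l))
  obtain ⟨ι, w, μ, hw⟩ := exists_hilbertBasis_eigenvectors hsymm hcompact
  let c : ι → ℝ≥0 := fun i => ∑ l ∈ L, ‖D l (w i)‖₊ ^ 2
  have hμ : ∀ i, μ i = ((c i : ℝ) : 𝕜) := fun i => by
    have h := (hsymm (w i) (w i)).symm.trans (inner_K (w i) (w i))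
    simpa [hw, inner_smul_right, inner_self_eq_norm_sq_to_K, w.orthonormal.1 i, c] using h
  refine ⟨ι, w, c, fun y => ?_⟩
  have hasSum_form : HasSum (fun i => (c i : ℝ) * ‖⟪w i, y⟫_𝕜‖ ^ 2) (∑ l ∈ L, ‖D l y‖ ^ 2) := by
    rw [← RCLike.hasSum_ofReal 𝕜]
    convert! w.hasSum_inner_mul_inner (K y) y using 1
    · ext i
      have h : ⟪K y, w i⟫_𝕜 = ((c i : ℝ) : 𝕜) * ⟪y, w i⟫_𝕜 := by
        rw [← hμ, ← inner_smul_right, ← hw]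
        exact hsymm y (w i)
      rw [h, mul_assoc, ← inner_conj_symm y, RCLike.conj_mul]
      push_cast
      rfl
    · simp [inner_K, inner_self_eq_norm_sq_to_K]
  have h := ENNReal.ofReal_tsum_of_nonneg (fun i => by positivity) hasSum_form.summable
  rw [hasSum_form.tsum_eq, ENNReal.ofReal_sum_of_nonneg fun l _ => sq_nonneg _] at h
  simpa [diagForm, ENNReal.ofReal_mul, ENNReal.ofReal_pow, ofReal_norm] using h

theorem exists_enorm_sq_eq_diagForm {G : Type*} [NormedAddCommGroup G] [InnerProductSpace 𝕜 G]
    [CompleteSpace H] [CompleteSpace G] {D : H →L[𝕜] G} (hD : IsCompactOperator D) :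
    ∃ (ι : Type (max v u)) (w : HilbertBasis ι 𝕜 H) (c : ι → ℝ≥0),
      ∀ y, ‖D y‖ₑ ^ 2 = diagForm w c y := by
  simpa using exists_sum_enorm_sq_eq_diagForm {()} (fun _ => D) fun _ _ => hD

theorem diagForm_sum_inner_div_smul (w : HilbertBasis ι 𝕜 H) (c : ι → ℝ≥0) (F : Finset ι) (h : H) :
    diagForm w c (∑ i ∈ F, (⟪w i, h⟫_𝕜 / (c i : ℝ)) • w i) =
      (∑ i ∈ F, ‖⟪h, w i⟫_𝕜‖₊ ^ 2 / c i : ℝ≥0) := by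
  rw [diagForm_sum_smul, ENNReal.ofNNReal_finsetSum]
  refine Finset.sum_congr rfl fun i _ => ?_
  have hcoeff : ‖⟪w i, h⟫_𝕜 / ((c i : ℝ) : 𝕜)‖₊ = ‖⟪h, w i⟫_𝕜‖₊ / c i := by
    ext
    simp [norm_inner_symm (w i)]
  rw [enorm_eq_nnnorm, hcoeff, ← ENNReal.coe_pow, ← ENNReal.coe_mul]
  rcases eq_or_ne (c i) 0 with h0 | h0
  · simp [h0]
  · congr 1
    field_simp

theorem tsum_enorm_inner_sq_div_le_one (w : HilbertBasis ι 𝕜 H) (c : ι → ℝ≥0) {h : H}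
    (hh : ∀ y, ‖⟪h, y⟫_𝕜‖ₑ ^ 2 ≤ diagForm w c y) :
    ∑' i, ‖⟪h, w i⟫_𝕜‖ₑ ^ 2 / c i ≤ 1 := by
  rw [ENNReal.tsum_eq_iSup_sum]
  refine iSup_le fun F => ?_
  have hle : ∀ i, ‖⟪h, w i⟫_𝕜‖ₑ ^ 2 ≤ c i := fun i => by
    simpa [diagForm_apply_self] using hh (w i)
  let S : ℝ≥0 := ∑ i ∈ F, ‖⟪h, w i⟫_𝕜‖₊ ^ 2 / c i
  have coe_S : ∑ i ∈ F, ‖⟪h, w i⟫_𝕜‖ₑ ^ 2 / c i = S := by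
    rw [ENNReal.ofNNReal_finsetSum]
    refine Finset.sum_congr rfl fun i _ => ?_
    rcases eq_or_ne (c i) 0 with h0 | h0
    · simpa [h0] using hle i
    · simp [ENNReal.coe_div h0, enorm_eq_nnnorm]
  let y : H := ∑ i ∈ F, (⟪w i, h⟫_𝕜 / (c i : ℝ)) • w i
  have inner_y : ⟪h, y⟫_𝕜 = ((S : ℝ) : 𝕜) := by
    simp only [inner_sum, inner_smul_right, y, S]
    push_cast
    refine Finset.sum_congr rfl fun i _ => ?_
    rw [div_mul_eq_mul_div, ← inner_conj_symm (w i), RCLike.conj_mul]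
  have form_y : diagForm w c y = S := diagForm_sum_inner_div_smul w c F h
  have S_sq_le : S ^ 2 ≤ S := by
    have := hh y
    rw [inner_y, form_y] at this
    simpa [enorm_eq_nnnorm, ← ENNReal.coe_pow] using this
  rw [coe_S]
  exact_mod_cast le_of_not_gt fun hS : 1 < S =>
    (sq S ▸ S_sq_le).not_gt (lt_mul_of_one_lt_left (one_pos.trans hS) hS)

theorem tsum_rpow_le_tsum_enorm_rpow (w : HilbertBasis ι 𝕜 H) (c : ι → ℝ≥0) (h : α → H)
    (hh : ∀ y, ∑' a, ‖⟪h a, y⟫_𝕜‖ₑ ^ 2 = diagForm w c y) {p : ℝ} (hp : 0 < p) (hp2 : p ≤ 2) :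
    ∑' i, (c i : ℝ≥0∞) ^ (p / 2) ≤ ∑' a, ‖h a‖ₑ ^ p := by
  refine (tsum_tsum_rpow_le (fun a i => ‖⟪h a, w i⟫_𝕜‖ₑ ^ 2)
    (fun i => (hh _).trans (diagForm_apply_self w c i)) (fun i => ENNReal.coe_ne_top)
    (fun a => tsum_enorm_inner_sq_div_le_one w c fun y => ?_) (by positivity) (by linarith)).trans
    (ENNReal.tsum_le_tsum fun a => ?_)
  · exact (ENNReal.le_tsum a).trans (hh y).le
  · have hnorm : ∑' i, ‖⟪h a, w i⟫_𝕜‖ₑ ^ 2 = ‖h a‖ₑ ^ 2 := by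
      rw [← tsum_enorm_inner_sq w]
      exact tsum_congr fun i => by rw [← ofReal_norm, norm_inner_symm, ofReal_norm]
    rw [hnorm, ← ENNReal.rpow_natCast, ← ENNReal.rpow_mul]
    exact le_of_eq (by congr 1; push_cast; ring)

theorem diagForm_le_mul_enorm_sq (w : HilbertBasis ι 𝕜 H) {c : ι → ℝ≥0} {t : ℝ≥0∞} {y : H}
    (h : ∀ i, ⟪w i, y⟫_𝕜 ≠ 0 → c i ≤ t) : diagForm w c y ≤ t * ‖y‖ₑ ^ 2 := by
  rw [← tsum_enorm_inner_sq w, ← ENNReal.tsum_mul_left]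
  refine ENNReal.tsum_le_tsum fun i => ?_
  rcases eq_or_ne ⟪w i, y⟫_𝕜 0 with hi | hi
  · simp [hi]
  · exact mul_le_mul_left (h i hi) _

theorem mul_enorm_sq_le_diagForm (w : HilbertBasis ι 𝕜 H) {c : ι → ℝ≥0} {t : ℝ≥0∞} {y : H}
    (h : ∀ i, ⟪w i, y⟫_𝕜 ≠ 0 → t ≤ c i) : t * ‖y‖ₑ ^ 2 ≤ diagForm w c y := by
  rw [← tsum_enorm_inner_sq w, ← ENNReal.tsum_mul_left]
  refine ENNReal.tsum_le_tsum fun i => ?_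
  rcases eq_or_ne ⟪w i, y⟫_𝕜 0 with hi | hi
  · simp [hi]
  · exact mul_le_mul_left (h i hi) _

theorem inner_eq_zero_of_mem_span_image {v : ι → H} (hv : Orthonormal 𝕜 v) {s : Set ι} {i : ι}
    (hi : i ∉ s) {x : H} (hx : x ∈ Submodule.span 𝕜 (v '' s)) : ⟪v i, x⟫_𝕜 = 0 := by
  have hle : Submodule.span 𝕜 (v '' s) ≤ (Submodule.span 𝕜 {v i})ᗮ := Submodule.span_le.2 <| by
    rintro _ ⟨m, hm, rfl⟩
    exact Submodule.mem_orthogonal_singleton_iff_inner_right.2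
      (hv.2 (ne_of_mem_of_not_mem hm hi).symm)
  exact Submodule.mem_orthogonal_singleton_iff_inner_right.1 (hle hx)

end DiagForm

section SingularValue

variable {ι : Type*} {H : Type*} [NormedAddCommGroup H] [InnerProductSpace ℂ H]

theorem singularValue_eq_infEDist (n : ℕ) (T : H →L[ℂ] H) :
    singularValue n T = Metric.infEDist T {R | (R : H →ₗ[ℂ] H).rank ≤ n} := by
  simp [singularValue, Metric.infEDist, edist_eq_enorm_sub]

theorem continuous_singularValue (n : ℕ) : Continuous (singularValue n : (H →L[ℂ] H) → ℝ≥0∞) := by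
  simpa only [← singularValue_eq_infEDist] using
    Metric.continuous_infEDist (s := {R : H →L[ℂ] H | (R : H →ₗ[ℂ] H).rank ≤ n})

theorem singularValue_comp_le (n : ℕ) (M T : H →L[ℂ] H) :
    singularValue n (M ∘L T) ≤ ‖M‖ₑ * singularValue n T := by
  have : Nonempty {R : H →L[ℂ] H // (R : H →ₗ[ℂ] H).rank ≤ n} := ⟨0, by simp⟩
  rw [singularValue, singularValue, iInf_subtype', iInf_subtype', ENNReal.mul_iInf (by simp)]
  refine le_iInf fun ⟨R, hR⟩ => ?_
  have hMR : ((M ∘L R : H →L[ℂ] H) : H →ₗ[ℂ] H).rank ≤ n :=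
    (LinearMap.rank_comp_le_right (R : H →ₗ[ℂ] H) (M : H →ₗ[ℂ] H)).trans hR
  refine (iInf_le _ ⟨M ∘L R, hMR⟩).trans ?_
  rw [← ContinuousLinearMap.comp_sub]
  exact ContinuousLinearMap.opENorm_comp_le M (T - R)

theorem schattenNorm_rpow {p : ℝ} (hp : 0 < p) (T : H →L[ℂ] H) :
    schattenNorm p T ^ p = ∑' n, singularValue n T ^ p := by
  rw [schattenNorm, ← ENNReal.rpow_mul, one_div_mul_cancel hp.ne', ENNReal.rpow_one]

theorem lowerSemicontinuous_schattenNorm {p : ℝ} (hp : 0 < p) :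
    LowerSemicontinuous (schattenNorm p : (H →L[ℂ] H) → ℝ≥0∞) := by
  refine Continuous.comp_lowerSemicontinuous (g := fun x : ℝ≥0∞ => x ^ (1 / p))
    ENNReal.continuous_rpow_const
    (lowerSemicontinuous_tsum fun n =>
      (ENNReal.continuous_rpow_const.comp (continuous_singularValue n)).lowerSemicontinuous)
    (ENNReal.monotone_rpow_of_nonneg (by positivity))

theorem schattenNorm_comp_le {p : ℝ} (hp : 0 < p) (M T : H →L[ℂ] H) :
    schattenNorm p (M ∘L T) ≤ ‖M‖ₑ * schattenNorm p T := by
  rw [← ENNReal.rpow_le_rpow_iff hp, ENNReal.mul_rpow_of_nonneg _ _ hp.le, schattenNorm_rpow hp,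
    schattenNorm_rpow hp, ← ENNReal.tsum_mul_left]
  refine ENNReal.tsum_le_tsum fun n => ?_
  rw [← ENNReal.mul_rpow_of_nonneg _ _ hp.le]
  exact ENNReal.rpow_le_rpow (singularValue_comp_le n M T) hp.le

theorem isCompactOperator_of_rank_le {R : H →L[ℂ] H} {n : ℕ} (hR : (R : H →ₗ[ℂ] H).rank ≤ n) :
    IsCompactOperator R := by
  have : FiniteDimensional ℂ (R : H →ₗ[ℂ] H).range :=
    Module.rank_lt_aleph0_iff.1 (hR.trans_lt Cardinal.natCast_lt_aleph0)
  have : ProperSpace (R : H →ₗ[ℂ] H).range := FiniteDimensional.proper ℂ _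
  exact (isCompactOperator_of_locallyCompactSpace_dom
    (R.codRestrict _ (LinearMap.mem_range_self (R : H →ₗ[ℂ] H)))).clm_comp
      (R : H →ₗ[ℂ] H).range.subtypeL

theorem enorm_sq_le_of_forall {T : H →L[ℂ] H} {t : ℝ≥0∞} (h : ∀ y, ‖T y‖ₑ ^ 2 ≤ t * ‖y‖ₑ ^ 2) :
    ‖T‖ₑ ^ 2 ≤ t := by
  have hsqrt : (t ^ (1 / 2 : ℝ)) ^ 2 = t := by
    rw [← ENNReal.rpow_natCast, ← ENNReal.rpow_mul]
    norm_num
  rw [← hsqrt]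
  gcongr
  refine T.opENorm_le_bound fun y => (ENNReal.pow_le_pow_left_iff two_ne_zero).1 ?_
  rw [mul_pow, hsqrt]
  exact h y

theorem singularValue_sq_le_iSup (w : HilbertBasis ι ℂ H) (c : ι → ℝ≥0) {T : H →L[ℂ] H}
    (hT : ∀ y, ‖T y‖ₑ ^ 2 ≤ diagForm w c y) {F : Finset ι} {n : ℕ} (hF : F.card ≤ n) :
    singularValue n T ^ 2 ≤ ⨆ i ∉ F, (c i : ℝ≥0∞) := by
  classical
  let U : Submodule ℂ H := Submodule.span ℂ (F.image w)
  have : FiniteDimensional ℂ U := FiniteDimensional.span_finset ℂ (F.image w)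
  have hrank : ((T ∘L U.starProjection : H →L[ℂ] H) : H →ₗ[ℂ] H).rank ≤ n := calc
    ((T ∘L U.starProjection : H →L[ℂ] H) : H →ₗ[ℂ] H).rank
      ≤ (U.starProjection : H →ₗ[ℂ] H).rank :=
        LinearMap.rank_comp_le_right (U.starProjection : H →ₗ[ℂ] H) (T : H →ₗ[ℂ] H)
    _ ≤ Module.rank ℂ U :=
        Submodule.rank_mono (by rintro _ ⟨x, rfl⟩; exact U.starProjection_apply_mem x)
    _ ≤ (F.image w).card := rank_span_finset_le _
    _ ≤ n := by exact_mod_cast Finset.card_image_le.trans hF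
  have hle : singularValue n T ≤ ‖T - T ∘L U.starProjection‖ₑ :=
    iInf₂_le (T ∘L U.starProjection) hrank
  refine (pow_le_pow_left' hle 2).trans (enorm_sq_le_of_forall fun y => ?_)
  let z := Uᗮ.starProjection y
  have hz : z = y - U.starProjection y := Submodule.starProjection_orthogonal_val y
  have inner_z : ∀ i ∈ F, ⟪w i, z⟫_ℂ = 0 := fun i hi =>
    (Submodule.mem_orthogonal _ _).1 (Uᗮ.starProjection_apply_mem y) _
      (Submodule.subset_span (Finset.mem_coe.2 (Finset.mem_image_of_mem w hi)))
  have norm_z : ‖z‖ₑ ≤ ‖y‖ₑ :=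
    enorm_le_iff_norm_le.2 (Uᗮ.norm_starProjection_apply_le y)
  calc ‖(T - T ∘L U.starProjection) y‖ₑ ^ 2 = ‖T z‖ₑ ^ 2 := by simp [hz]
    _ ≤ diagForm w c z := hT z
    _ ≤ (⨆ i ∉ F, (c i : ℝ≥0∞)) * ‖z‖ₑ ^ 2 := diagForm_le_mul_enorm_sq w fun i hi =>
        le_iSup₂ (f := fun i (_ : i ∉ F) => (c i : ℝ≥0∞)) i fun hiF => hi (inner_z i hiF)
    _ ≤ (⨆ i ∉ F, (c i : ℝ≥0∞)) * ‖y‖ₑ ^ 2 := by gcongr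

theorem iInf_le_enorm_sub_sq (w : HilbertBasis ι ℂ H) (c : ι → ℝ≥0) {T R : H →L[ℂ] H}
    (hT : ∀ y, diagForm w c y ≤ ‖T y‖ₑ ^ 2) {F : Finset ι} {n : ℕ} (hF : F.card = n + 1)
    (hR : (R : H →ₗ[ℂ] H).rank ≤ n) : ⨅ i ∈ F, (c i : ℝ≥0∞) ≤ ‖T - R‖ₑ ^ 2 := by
  let U : Submodule ℂ H := Submodule.span ℂ (w '' F)
  have : FiniteDimensional ℂ U := FiniteDimensional.span_of_finite ℂ (F.finite_toSet.image w)
  have : FiniteDimensional ℂ (R : H →ₗ[ℂ] H).range :=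
    Module.rank_lt_aleph0_iff.1 (hR.trans_lt Cardinal.natCast_lt_aleph0)
  have finrank_U : Module.finrank ℂ U = n + 1 := by
    have h := finrank_span_eq_card
      (w.orthonormal.linearIndependent.comp ((↑) : F → ι) Subtype.val_injective)
    rwa [Set.range_comp, Subtype.range_coe_subtype, Finset.setOfPred_mem, Fintype.card_coe, hF] at h
  have finrank_range : Module.finrank ℂ (R : H →ₗ[ℂ] H).range ≤ n :=
    Module.finrank_le_of_rank_le hR
  obtain ⟨x, hx, hx0⟩ := Submodule.exists_mem_ne_zero_of_ne_bot <|
    LinearMap.ker_ne_bot_of_finrank_lt (f := (R : H →ₗ[ℂ] H).rangeRestrict ∘ₗ U.subtype)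
      (by omega)
  have hRx : R x = 0 := congrArg Subtype.val (LinearMap.mem_ker.1 hx)
  refine (ENNReal.mul_le_mul_iff_left (c := ‖(x : H)‖ₑ ^ 2) (by simpa using hx0) (by simp)).1 ?_
  calc (⨅ i ∈ F, (c i : ℝ≥0∞)) * ‖(x : H)‖ₑ ^ 2 ≤ diagForm w c x :=
        mul_enorm_sq_le_diagForm w fun i hi => iInf₂_le i <| not_imp_comm.1
          (fun hiF => inner_eq_zero_of_mem_span_image w.orthonormal hiF x.2) hi
    _ ≤ ‖T x‖ₑ ^ 2 := hT x
    _ = ‖(T - R) x‖ₑ ^ 2 := by simp [hRx]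
    _ ≤ ‖T - R‖ₑ ^ 2 * ‖(x : H)‖ₑ ^ 2 := by
        rw [← mul_pow]
        gcongr
        exact (T - R).le_opENorm x

theorem sq_rpow_half (x : ℝ≥0∞) (p : ℝ) : (x ^ 2) ^ (p / 2) = x ^ p := by
  rw [← ENNReal.rpow_natCast, ← ENNReal.rpow_mul]
  congr 1
  push_cast
  ring

theorem iInf_rpow_le_singularValue_rpow (w : HilbertBasis ι ℂ H) (c : ι → ℝ≥0) {T : H →L[ℂ] H}
    (hT : ∀ y, diagForm w c y ≤ ‖T y‖ₑ ^ 2) {F : Finset ι} {n : ℕ} (hF : F.card = n + 1)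
    {p : ℝ} (hp : 0 < p) :
    ⨅ i ∈ F, (c i : ℝ≥0∞) ^ (p / 2) ≤ singularValue n T ^ p := by
  let e := ENNReal.orderIsoRpow p hp
  change _ ≤ e _
  simp_rw [singularValue, e.map_iInf]
  refine le_iInf₂ fun R hR => ?_
  have h := (ENNReal.orderIsoRpow (p / 2) (by positivity)).monotone
    (iInf_le_enorm_sub_sq w c hT hF hR)
  simpa only [OrderIso.map_iInf, ENNReal.orderIsoRpow_apply, e, sq_rpow_half] using h

theorem schattenNorm_rpow_le_tsum (w : HilbertBasis ι ℂ H) (c : ι → ℝ≥0) {T : H →L[ℂ] H}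
    (hT : ∀ y, ‖T y‖ₑ ^ 2 ≤ diagForm w c y) {p : ℝ} (hp : 0 < p) :
    schattenNorm p T ^ p ≤ ∑' i, (c i : ℝ≥0∞) ^ (p / 2) := by
  rw [schattenNorm_rpow hp]
  refine tsum_le_tsum_of_le_iSup fun F n hF => ?_
  have h := (ENNReal.orderIsoRpow (p / 2) (by positivity)).monotone
    (singularValue_sq_le_iSup w c hT hF)
  rw [(ENNReal.orderIsoRpow (p / 2) (by positivity)).map_iSup₂] at h
  simpa only [ENNReal.orderIsoRpow_apply, sq_rpow_half] using h

theorem tsum_le_schattenNorm_rpow (w : HilbertBasis ι ℂ H) (c : ι → ℝ≥0) {T : H →L[ℂ] H}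
    (hT : ∀ y, diagForm w c y ≤ ‖T y‖ₑ ^ 2) {p : ℝ} (hp : 0 < p) :
    ∑' i, (c i : ℝ≥0∞) ^ (p / 2) ≤ schattenNorm p T ^ p := by
  rw [schattenNorm_rpow hp]
  exact tsum_le_tsum_of_iInf_le fun F n hF => iInf_rpow_le_singularValue_rpow w c hT hF hp

variable [CompleteSpace H]

theorem isCompactOperator_of_schattenNorm_ne_top {p : ℝ} (hp : 0 < p) {T : H →L[ℂ] H}
    (hT : schattenNorm p T ≠ ∞) : IsCompactOperator T := by
  have hsum : ∑' n, singularValue n T ^ p ≠ ∞ := by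
    rw [← schattenNorm_rpow hp]
    exact ENNReal.rpow_ne_top_of_nonneg hp.le hT
  have dist_le : ∀ n, Metric.infEDist T {R : H →L[ℂ] H | IsCompactOperator R} ^ p ≤
      singularValue n T ^ p := fun n => by
    rw [singularValue_eq_infEDist]
    exact ENNReal.rpow_le_rpow (Metric.infEDist_anti fun R => isCompactOperator_of_rank_le) hp.le
  have hmem : T ∈ closure {R : H →L[ℂ] H | IsCompactOperator R} := by
    rw [Metric.mem_closure_iff_infEDist_zero, ← ENNReal.rpow_eq_zero_iff_of_pos hp,
      ← nonpos_iff_eq_zero]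
    exact ge_of_tendsto' (ENNReal.tendsto_atTop_zero_of_tsum_ne_top hsum) dist_le
  rwa [isClosed_setOfPred_isCompactOperator.closure_eq] at hmem

theorem enorm_adjoint (T : H →L[ℂ] H) : ‖adjoint T‖ₑ = ‖T‖ₑ := by
  rw [← ofReal_norm, LinearIsometryEquiv.norm_map, ofReal_norm]

theorem rank_adjoint_le {R : H →L[ℂ] H} {n : ℕ} (hR : (R : H →ₗ[ℂ] H).rank ≤ n) :
    (adjoint R : H →ₗ[ℂ] H).rank ≤ n := by
  let V := (R : H →ₗ[ℂ] H).range
  have : FiniteDimensional ℂ V :=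
    Module.rank_lt_aleph0_iff.1 (hR.trans_lt Cardinal.natCast_lt_aleph0)
  have hPR : V.starProjection ∘L R = R :=
    ContinuousLinearMap.ext fun x =>
      Submodule.starProjection_eq_self_iff.2 (LinearMap.mem_range_self (R : H →ₗ[ℂ] H) x)
  have hRP : adjoint R ∘L V.starProjection = adjoint R := by
    conv_rhs => rw [← hPR, ContinuousLinearMap.adjoint_comp,
      (isSelfAdjoint_starProjection V).adjoint_eq]
  rw [← hRP]
  refine (LinearMap.rank_comp_le_right (V.starProjection : H →ₗ[ℂ] H) _).trans (le_trans ?_ hR)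
  exact Submodule.rank_mono (by rintro _ ⟨x, rfl⟩; exact V.starProjection_apply_mem x)

theorem singularValue_adjoint (n : ℕ) (T : H →L[ℂ] H) :
    singularValue n (adjoint T) = singularValue n T := by
  have hle : ∀ S : H →L[ℂ] H, singularValue n (adjoint S) ≤ singularValue n S := fun S =>
    le_iInf₂ fun R hR => (iInf₂_le (adjoint R) (rank_adjoint_le hR)).trans_eq <| by
      rw [← map_sub, enorm_adjoint]
  exact (hle T).antisymm (by simpa using hle (adjoint T))

theorem schattenNorm_adjoint (p : ℝ) (T : H →L[ℂ] H) :
    schattenNorm p (adjoint T) = schattenNorm p T := by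
  simp only [schattenNorm, singularValue_adjoint]

end SingularValue

section BlockSum

universe u

variable {H : Type u} {σ α : Type*} [NormedAddCommGroup H] [InnerProductSpace ℂ H]
  [CompleteSpace H] {p : ℝ}

theorem enorm_sum_adjoint_sq_le {L : Finset σ} {Φ : σ → H →L[ℂ] H} {B : ℝ≥0}
    (hΦ : ∀ x, ∑ l ∈ L, ‖Φ l x‖ₑ ^ 2 ≤ B * ‖x‖ₑ ^ 2) (v : σ → H) :
    ‖∑ l ∈ L, adjoint (Φ l) (v l)‖ₑ ^ 2 ≤ B * ∑ l ∈ L, ‖v l‖ₑ ^ 2 := by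
  let u := ∑ l ∈ L, adjoint (Φ l) (v l)
  have sum_le : ∑ l ∈ L, ‖Φ l u‖ ^ 2 ≤ B * ‖u‖ ^ 2 := by
    have h := hΦ u
    simp only [enorm_eq_nnnorm] at h
    norm_cast at h
    simpa using NNReal.coe_le_coe.2 h
  have sq_le : ‖u‖ ^ 2 ≤ ∑ l ∈ L, ‖Φ l u‖ * ‖v l‖ := calc
    ‖u‖ ^ 2 = ∑ l ∈ L, RCLike.re ⟪Φ l u, v l⟫_ℂ := by
      rw [norm_sq_eq_re_inner (𝕜 := ℂ), ← map_sum]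
      simp only [← ContinuousLinearMap.adjoint_inner_right, ← inner_sum, u]
    _ ≤ ∑ l ∈ L, ‖Φ l u‖ * ‖v l‖ := Finset.sum_le_sum fun l _ => re_inner_le_norm _ _
  have mul_le : ‖u‖ ^ 2 * ‖u‖ ^ 2 ≤ ‖u‖ ^ 2 * (B * ∑ l ∈ L, ‖v l‖ ^ 2) := calc
    ‖u‖ ^ 2 * ‖u‖ ^ 2 ≤ (∑ l ∈ L, ‖Φ l u‖ * ‖v l‖) ^ 2 := by
      rw [← sq]
      gcongr
    _ ≤ (∑ l ∈ L, ‖Φ l u‖ ^ 2) * ∑ l ∈ L, ‖v l‖ ^ 2 := Finset.sum_mul_sq_le_sq_mul_sq _ _ _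
    _ ≤ (B * ‖u‖ ^ 2) * ∑ l ∈ L, ‖v l‖ ^ 2 := by gcongr
    _ = ‖u‖ ^ 2 * (B * ∑ l ∈ L, ‖v l‖ ^ 2) := by ring
  have le : ‖u‖ ^ 2 ≤ B * ∑ l ∈ L, ‖v l‖ ^ 2 := by
    rcases (sq_nonneg ‖u‖).eq_or_lt with h0 | h0
    · rw [← h0]
      positivity
    · exact le_of_mul_le_mul_left mul_le h0
  simp only [enorm_eq_nnnorm]
  norm_cast
  simpa [← NNReal.coe_le_coe] using le

theorem schattenNorm_rpow_le_of_enorm_sq_le (hp : 0 < p) (hp2 : p ≤ 2) {L : Finset σ}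
    {T : H →L[ℂ] H} {X : σ → H →L[ℂ] H} {B : ℝ≥0} (hX : ∀ l ∈ L, IsCompactOperator (X l))
    (hT : ∀ y, ‖T y‖ₑ ^ 2 ≤ B * ∑ l ∈ L, ‖X l y‖ₑ ^ 2) :
    schattenNorm p T ^ p ≤ (B : ℝ≥0∞) ^ (p / 2) * ∑ l ∈ L, schattenNorm p (X l) ^ p := by
  obtain ⟨ι, v, c, hc⟩ := exists_sum_enorm_sq_eq_diagForm L X hX
  choose κ w d hd using fun l : L => exists_enorm_sq_eq_diagForm (hX l l.2)
  let h : (Σ l : L, κ l) → H := fun a => ((NNReal.sqrt (d a.1 a.2) : ℝ) : ℂ) • w a.1 a.2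
  have enorm_sqrt : ∀ x : ℝ≥0, ‖((NNReal.sqrt x : ℝ) : ℂ)‖ₑ ^ 2 = x := fun x => by
    rw [← ofReal_norm, Complex.norm_real, NNReal.norm_eq, ENNReal.ofReal_coe_nnreal,
      ← ENNReal.coe_pow, NNReal.sq_sqrt]
  have sum_inner_h : ∀ y, ∑' a, ‖⟪h a, y⟫_ℂ‖ₑ ^ 2 = diagForm v c y := fun y => by
    rw [← hc, ENNReal.tsum_sigma', ← Finset.tsum_subtype]
    refine tsum_congr fun l => (hd l y).symm ▸ tsum_congr fun i => ?_
    rw [inner_smul_left, enorm_mul, mul_pow, Complex.conj_ofReal, enorm_sqrt]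
  have enorm_h : ∀ a, ‖h a‖ₑ ^ p = (d a.1 a.2 : ℝ≥0∞) ^ (p / 2) := fun a => by
    rw [enorm_smul, ← sq_rpow_half, mul_pow, enorm_sqrt, ← ofReal_norm, (w a.1).orthonormal.1]
    simp
  calc schattenNorm p T ^ p ≤ ∑' i, ((B * c i : ℝ≥0) : ℝ≥0∞) ^ (p / 2) :=
        schattenNorm_rpow_le_tsum v _ (fun y => by
          simpa [diagForm, mul_assoc, ENNReal.tsum_mul_left, hc] using hT y) hp
    _ = (B : ℝ≥0∞) ^ (p / 2) * ∑' i, (c i : ℝ≥0∞) ^ (p / 2) := by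
        simp only [ENNReal.coe_mul, ENNReal.mul_rpow_of_nonneg _ _ (half_pos hp).le,
          ENNReal.tsum_mul_left]
    _ ≤ (B : ℝ≥0∞) ^ (p / 2) * ∑' a, ‖h a‖ₑ ^ p := by
        gcongr
        exact tsum_rpow_le_tsum_enorm_rpow v c h sum_inner_h hp hp2
    _ = (B : ℝ≥0∞) ^ (p / 2) * ∑' (l : L) (i), (d l i : ℝ≥0∞) ^ (p / 2) := by
        simp only [enorm_h, ENNReal.tsum_sigma']
    _ ≤ (B : ℝ≥0∞) ^ (p / 2) * ∑ l ∈ L, schattenNorm p (X l) ^ p := by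
        rw [← Finset.tsum_subtype L fun l => schattenNorm p (X l) ^ p]
        gcongr with l
        exact tsum_le_schattenNorm_rpow (w l) (d l) (fun y => (hd l y).ge) hp

theorem schattenNorm_rpow_le_tsum_enorm_adjoint (hp : 0 < p) (hp2 : p ≤ 2) {Y : H →L[ℂ] H}
    (hY : IsCompactOperator Y) (e : HilbertBasis α ℂ H) :
    schattenNorm p Y ^ p ≤ ∑' a, ‖adjoint Y (e a)‖ₑ ^ p := by
  obtain ⟨ι, w, c, hc⟩ := exists_enorm_sq_eq_diagForm hY
  refine (schattenNorm_rpow_le_tsum w c (fun y => (hc y).le) hp).trans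
    (tsum_rpow_le_tsum_enorm_rpow w c _ (fun y => ?_) hp hp2)
  simp only [ContinuousLinearMap.adjoint_inner_left, tsum_enorm_inner_sq, hc]

theorem exists_hilbertBasis_tsum_enorm_rpow_le (hp : 0 < p) {T : H →L[ℂ] H}
    (hT : IsCompactOperator T) :
    ∃ (ι : Type u) (e : HilbertBasis ι ℂ H), ∑' i, ‖T (e i)‖ₑ ^ p ≤ schattenNorm p T ^ p := by
  obtain ⟨ι, e, c, hc⟩ := exists_enorm_sq_eq_diagForm hT
  refine ⟨ι, e, (tsum_congr fun i => ?_).trans_le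
    (tsum_le_schattenNorm_rpow e c (fun y => (hc y).ge) hp)⟩
  rw [← sq_rpow_half, hc, diagForm_apply_self]

theorem sum_mul_rpow_le (hp : 0 < p) (hp2 : p < 2) (L : Finset σ) (x y : σ → ℝ≥0∞) :
    ∑ l ∈ L, x l ^ p * y l ^ p ≤
      (∑ l ∈ L, x l ^ flat p) ^ (1 - p / 2) * (∑ l ∈ L, y l ^ 2) ^ (p / 2) := by
  have hflat : ∀ t : ℝ≥0∞, (t ^ flat p) ^ (1 - p / 2) = t ^ p := fun t => by
    have : 2 - p ≠ 0 := by linarith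
    rw [← ENNReal.rpow_mul, flat]
    congr 1
    field_simp
  have h := tsum_rpow_mul_rpow_le (fun l : L => x l ^ flat p) (fun l : L => y l ^ 2)
    (q := 1 - p / 2) (r := p / 2) (by linarith) (half_pos hp).le (by ring)
  simp only [hflat, sq_rpow_half] at h
  rwa [Finset.tsum_subtype L fun l => x l ^ p * y l ^ p,
    Finset.tsum_subtype L fun l => x l ^ flat p, Finset.tsum_subtype L fun l => y l ^ 2] at h

theorem sum_mul_schattenNorm_comp_rpow_le (hp : 0 < p) (hp2 : p < 2) {L : Finset σ} {A : H →L[ℂ] H}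
    (hA : schattenNorm p A ≠ ∞) {S : σ → H →L[ℂ] H} {N : ℝ≥0}
    (hS : ∀ x, ∑ l ∈ L, ‖adjoint (S l) x‖ₑ ^ 2 ≤ N * ‖x‖ₑ ^ 2) (κ : σ → ℝ≥0∞) :
    ∑ l ∈ L, κ l ^ p * schattenNorm p (A ∘L S l) ^ p ≤
      (∑ l ∈ L, κ l ^ flat p) ^ (1 - p / 2) * (N : ℝ≥0∞) ^ (p / 2) * schattenNorm p A ^ p := by
  have compact_adjoint : IsCompactOperator (adjoint A) :=
    isCompactOperator_of_schattenNorm_ne_top hp (by rwa [schattenNorm_adjoint])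
  obtain ⟨ι, e, he⟩ := exists_hilbertBasis_tsum_enorm_rpow_le hp compact_adjoint
  rw [schattenNorm_adjoint] at he
  have compact_comp : ∀ l, IsCompactOperator (A ∘L S l) := fun l =>
    (isCompactOperator_of_schattenNorm_ne_top hp hA).comp_clm (S l)
  calc ∑ l ∈ L, κ l ^ p * schattenNorm p (A ∘L S l) ^ p
      ≤ ∑ l ∈ L, κ l ^ p * ∑' i, ‖adjoint (S l) (adjoint A (e i))‖ₑ ^ p := by
        gcongr with l
        simpa only [ContinuousLinearMap.adjoint_comp, ContinuousLinearMap.comp_apply] using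
          schattenNorm_rpow_le_tsum_enorm_adjoint hp hp2.le (compact_comp l) e
    _ = ∑' i, ∑ l ∈ L, κ l ^ p * ‖adjoint (S l) (adjoint A (e i))‖ₑ ^ p := by
        rw [Summable.tsum_finsetSum fun _ _ => ENNReal.summable]
        simp only [ENNReal.tsum_mul_left]
    _ ≤ ∑' i, (∑ l ∈ L, κ l ^ flat p) ^ (1 - p / 2) * (N * ‖adjoint A (e i)‖ₑ ^ 2) ^ (p / 2) :=
        ENNReal.tsum_le_tsum fun i => (sum_mul_rpow_le hp hp2 L _ _).trans <| by
          gcongr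
          exact hS _
    _ = (∑ l ∈ L, κ l ^ flat p) ^ (1 - p / 2) * (N : ℝ≥0∞) ^ (p / 2) *
          ∑' i, ‖adjoint A (e i)‖ₑ ^ p := by
        simp only [ENNReal.mul_rpow_of_nonneg _ _ (half_pos hp).le, sq_rpow_half,
          ENNReal.tsum_mul_left, mul_assoc]
    _ ≤ _ := by gcongr

theorem schattenNorm_sum_comp_le (hp : 0 < p) (hp2 : p < 2) {L : Finset σ} {A : H →L[ℂ] H}
    (hA : schattenNorm p A ≠ ∞) {S Φ : σ → H →L[ℂ] H} {N B : ℝ≥0}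
    (hS : ∀ x, ∑ l ∈ L, ‖adjoint (S l) x‖ₑ ^ 2 ≤ N * ‖x‖ₑ ^ 2)
    (hΦ : ∀ x, ∑ l ∈ L, ‖Φ l x‖ₑ ^ 2 ≤ B * ‖x‖ₑ ^ 2) (M : σ → H →L[ℂ] H) :
    schattenNorm p (∑ l ∈ L, M l ∘L (A ∘L S l) ∘L Φ l) ≤
      (B * N : ℝ≥0∞) ^ (1 / 2 : ℝ) * (∑ l ∈ L, ‖M l‖ₑ ^ flat p) ^ (1 / flat p) *
        schattenNorm p A := by
  let X : σ → H →L[ℂ] H := fun l => M l ∘L (A ∘L S l)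
  have compact_X : ∀ l, IsCompactOperator (adjoint (X l)) := fun l => by
    have h := isCompactOperator_of_schattenNorm_ne_top hp ((schattenNorm_adjoint p A).trans_ne hA)
    simpa only [X, ContinuousLinearMap.adjoint_comp, ContinuousLinearMap.comp_assoc] using!
      (h.comp_clm (adjoint (M l))).clm_comp (adjoint (S l))
  have enorm_adjoint_le : ∀ y, ‖adjoint (∑ l ∈ L, X l ∘L Φ l) y‖ₑ ^ 2 ≤
      B * ∑ l ∈ L, ‖adjoint (X l) y‖ₑ ^ 2 := fun y => by
    simpa only [map_sum, ContinuousLinearMap.adjoint_comp, sum_apply,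
      ContinuousLinearMap.comp_apply] using enorm_sum_adjoint_sq_le hΦ fun l => adjoint (X l) y
  rw [← ENNReal.rpow_le_rpow_iff hp]
  calc schattenNorm p (∑ l ∈ L, X l ∘L Φ l) ^ p
      ≤ (B : ℝ≥0∞) ^ (p / 2) * ∑ l ∈ L, schattenNorm p (X l) ^ p := by
        simpa only [schattenNorm_adjoint] using schattenNorm_rpow_le_of_enorm_sq_le hp hp2.le
          (fun l _ => compact_X l) enorm_adjoint_le
    _ ≤ (B : ℝ≥0∞) ^ (p / 2) * ∑ l ∈ L, ‖M l‖ₑ ^ p * schattenNorm p (A ∘L S l) ^ p := by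
        gcongr with l
        rw [← ENNReal.mul_rpow_of_nonneg _ _ hp.le]
        gcongr
        exact schattenNorm_comp_le hp (M l) (A ∘L S l)
    _ ≤ (B : ℝ≥0∞) ^ (p / 2) * ((∑ l ∈ L, ‖M l‖ₑ ^ flat p) ^ (1 - p / 2) *
          (N : ℝ≥0∞) ^ (p / 2) * schattenNorm p A ^ p) := by
        gcongr
        exact sum_mul_schattenNorm_comp_rpow_le hp hp2 hA hS _
    _ = _ := by
        have hflat : 1 / flat p * p = 1 - p / 2 := by
          have : 2 - p ≠ 0 := by linarith
          rw [flat]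
          field_simp
        simp only [ENNReal.mul_rpow_of_nonneg _ _ hp.le, ← ENNReal.rpow_mul, hflat,
          ENNReal.mul_rpow_of_nonneg _ _ one_half_pos.le, one_div_mul_eq_div]
        ring

end BlockSum

section MulOp

variable {X σ 𝕜 : Type*} [RCLike 𝕜] [MeasurableSpace X] {μ : Measure X}

/-- Multiplication by the essentially bounded function `m`, as an operator on `L₂(μ)`. -/
noncomputable def mulOp (m : X → 𝕜) (hm : MemLp m ∞ μ) : Lp 𝕜 2 μ →L[𝕜] Lp 𝕜 2 μ :=
  (ContinuousLinearMap.mul 𝕜 𝕜).holderL μ ∞ 2 2 (hm.toLp m)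

theorem coeFn_mulOp {m : X → 𝕜} (hm : MemLp m ∞ μ) (g : Lp 𝕜 2 μ) :
    mulOp m hm g =ᵐ[μ] fun t => m t * g t := by
  filter_upwards [hm.coeFn_toLp, ContinuousLinearMap.coeFn_holder (r := 2)
    (ContinuousLinearMap.mul 𝕜 𝕜) (hm.toLp m) g] with t hmt hholder
  rw [← hmt]
  exact hholder

theorem enorm_mulOp_le {m : X → 𝕜} (hm : MemLp m ∞ μ) : ‖mulOp m hm‖ₑ ≤ eLpNorm m ∞ μ := by
  refine (mulOp m hm).opENorm_le_bound fun g => ?_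
  rw [Lp.enorm_def, Lp.enorm_def, eLpNorm_congr_ae (coeFn_mulOp hm g)]
  exact eLpNorm_smul_le_eLpNorm_top_mul_eLpNorm 2 (Lp.aestronglyMeasurable g) m

theorem enorm_sq_eq_lintegral (g : Lp 𝕜 2 μ) : ‖g‖ₑ ^ 2 = ∫⁻ t, ‖g t‖ₑ ^ 2 ∂μ := by
  rw [Lp.enorm_def, eLpNorm_eq_lintegral_rpow_enorm_toReal two_ne_zero ENNReal.ofNat_ne_top,
    ← ENNReal.rpow_natCast, ← ENNReal.rpow_mul]
  simp

theorem sum_enorm_mulOp_sq_le (L : Finset σ) {m : σ → X → 𝕜} (hm : ∀ l, MemLp (m l) ∞ μ)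
    {c : ℝ≥0∞} (hc : ∀ᵐ t ∂μ, ∑ l ∈ L, ‖m l t‖ₑ ^ 2 ≤ c) (g : Lp 𝕜 2 μ) :
    ∑ l ∈ L, ‖mulOp (m l) (hm l) g‖ₑ ^ 2 ≤ c * ‖g‖ₑ ^ 2 := by
  have measurable_g : AEMeasurable (fun t => ‖g t‖ₑ ^ 2) μ :=
    (Lp.aestronglyMeasurable g).enorm.pow_const 2
  calc ∑ l ∈ L, ‖mulOp (m l) (hm l) g‖ₑ ^ 2 = ∑ l ∈ L, ∫⁻ t, ‖m l t‖ₑ ^ 2 * ‖g t‖ₑ ^ 2 ∂μ := by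
        refine Finset.sum_congr rfl fun l _ => ?_
        rw [enorm_sq_eq_lintegral]
        refine lintegral_congr_ae ?_
        filter_upwards [coeFn_mulOp (hm l) g] with t ht
        rw [ht, enorm_mul, mul_pow]
    _ = ∫⁻ t, ∑ l ∈ L, ‖m l t‖ₑ ^ 2 * ‖g t‖ₑ ^ 2 ∂μ :=
        (lintegral_finsetSum' L fun l _ => ((hm l).1.enorm.pow_const 2).mul measurable_g).symm
    _ ≤ ∫⁻ t, c * ‖g t‖ₑ ^ 2 ∂μ := by
        refine lintegral_mono_ae ?_
        filter_upwards [hc] with t ht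
        rw [← Finset.sum_mul]
        gcongr
    _ = c * ‖g‖ₑ ^ 2 := by
        rw [lintegral_const_mul'' _ measurable_g, ← enorm_sq_eq_lintegral]

theorem adjoint_mulOp {m : X → 𝕜} (hm : MemLp m ∞ μ) :
    adjoint (mulOp m hm) = mulOp (star m) hm.star := by
  symm
  rw [ContinuousLinearMap.eq_adjoint_iff]
  intro f g
  rw [L2.inner_def, L2.inner_def]
  refine integral_congr_ae ?_
  filter_upwards [coeFn_mulOp hm.star f, coeFn_mulOp hm g] with t hf hg
  simp only [hf, hg, RCLike.inner_apply, map_mul, Pi.star_apply, RCLike.star_def, RCLike.conj_conj]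
  ring

end MulOp

section IntegralOp

variable {σ : Type*}

theorem coeFn_integralOp {f : ℝ × ℝ → ℂ} (hf : MemLp f 2 volume)
    (g : Lp ℂ 2 (volume : Measure ℝ)) :
    integralOp f hf g =ᵐ[volume] fun y => ∫ x, f (x, y) * g x :=
  MemLp.coeFn_toLp (memLp_integral hf (Lp.memLp g)).1

theorem enorm_integralOp_le {f : ℝ × ℝ → ℂ} (hf : MemLp f 2 volume) :
    ‖integralOp f hf‖ₑ ≤ eLpNorm f 2 volume := by
  rw [← ofReal_norm]
  exact ENNReal.ofReal_le_of_le_toReal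
    (LinearMap.mkContinuous_norm_le _ ENNReal.toReal_nonneg _)

theorem integralOp_sum (L : Finset σ) {f : σ → ℝ × ℝ → ℂ} (hf : ∀ l, MemLp (f l) 2 volume) :
    integralOp (fun z => ∑ l ∈ L, f l z) (memLp_finsetSum L fun l _ => hf l) =
      ∑ l ∈ L, integralOp (f l) (hf l) := by
  ext1 g
  apply Lp.ext
  rw [sum_apply]
  filter_upwards [coeFn_integralOp (memLp_finsetSum L fun l _ => hf l) g,
    Lp.coeFn_finsetSum L fun l => integralOp (f l) (hf l) g,
    L.eventually_all.2 fun l _ => coeFn_integralOp (hf l) g,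
    L.eventually_all.2 fun l _ => memLp_slice (hf l)] with y hsum hcoe hterm hslice
  rw [hsum, hcoe, Finset.sum_apply, Finset.sum_congr rfl hterm]
  simp only [Finset.sum_mul]
  exact integral_finsetSum L fun l hl => (hslice l hl).integrable_mul (Lp.memLp g)

theorem integralOp_sub {f f' : ℝ × ℝ → ℂ} (hf : MemLp f 2 volume) (hf' : MemLp f' 2 volume) :
    integralOp (f - f') (hf.sub hf') = integralOp f hf - integralOp f' hf' := by
  ext1 g
  apply Lp.ext
  rw [sub_apply]
  filter_upwards [coeFn_integralOp (hf.sub hf') g, coeFn_integralOp hf g, coeFn_integralOp hf' g,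
    Lp.coeFn_sub (integralOp f hf g) (integralOp f' hf' g), memLp_slice hf,
    memLp_slice hf'] with y hdiff hfy hfy' hsub hslice hslice'
  rw [hdiff, hsub, Pi.sub_apply, hfy, hfy']
  simp only [Pi.sub_apply, sub_mul]
  exact integral_sub (hslice.integrable_mul (Lp.memLp g)) (hslice'.integrable_mul (Lp.memLp g))

theorem integralOp_mul_tensor {f : ℝ × ℝ → ℂ} (hf : MemLp f 2 volume) {u v b : ℝ → ℂ}
    (hu : MemLp u ∞ volume) (hv : MemLp v ∞ volume) (hb : MemLp b ∞ volume)
    (h : MemLp (fun z : ℝ × ℝ => u z.1 * v z.1 * b z.2 * f z) 2 volume) :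
    integralOp (fun z : ℝ × ℝ => u z.1 * v z.1 * b z.2 * f z) h =
      mulOp b hb ∘L (integralOp f hf ∘L mulOp u hu) ∘L mulOp v hv := by
  ext1 g
  apply Lp.ext
  simp only [ContinuousLinearMap.comp_apply]
  let g₁ := mulOp v hv g
  let g₂ := mulOp u hu g₁
  filter_upwards [coeFn_integralOp h g, coeFn_integralOp hf g₂,
    coeFn_mulOp hb (integralOp f hf g₂)] with y hop hopf hmul
  rw [hop, hmul, hopf, ← integral_const_mul]
  refine integral_congr_ae ?_
  filter_upwards [coeFn_mulOp hu g₁, coeFn_mulOp hv g] with x hux hvx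
  rw [hux, hvx]
  ring

end IntegralOp

section BoundedSeries

variable {X E ι σ : Type*} {mX : MeasurableSpace X} {μ : Measure X} [NormedAddCommGroup E]

theorem tendsto_eLpNorm_zero_of_dominated {q : ℝ≥0∞} (hq0 : q ≠ 0) (hq : q ≠ ∞) {l : Filter ι}
    [l.IsCountablyGenerated] {F : ι → X → E} {G : X → ℝ≥0∞}
    (hF : ∀ i, AEStronglyMeasurable (F i) μ) (hle : ∀ i, ∀ᵐ x ∂μ, ‖F i x‖ₑ ≤ G x)
    (hG : ∫⁻ x, G x ^ q.toReal ∂μ ≠ ∞) (hlim : ∀ᵐ x ∂μ, Tendsto (F · x) l (𝓝 0)) :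
    Tendsto (fun i => eLpNorm (F i) q μ) l (𝓝 0) := by
  have hqpos : 0 < q.toReal := ENNReal.toReal_pos hq0 hq
  have hpow : ∀ {u : ι → ℝ≥0∞} {r : ℝ}, 0 < r → Tendsto u l (𝓝 0) →
      Tendsto (fun i => u i ^ r) l (𝓝 0) := fun {u r} hr hu => by
    simpa only [ENNReal.zero_rpow_of_pos hr] using hu.ennrpow_const r
  have hint : Tendsto (fun i => ∫⁻ x, ‖F i x‖ₑ ^ q.toReal ∂μ) l (𝓝 0) := by
    rw [← lintegral_zero (μ := μ)]
    refine tendsto_lintegral_filter_of_dominated_convergence' (fun x => G x ^ q.toReal)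
      (.of_forall fun i => (hF i).enorm.pow_const _) (.of_forall fun i => ?_) hG ?_
    · exact (hle i).mono fun x hx => ENNReal.rpow_le_rpow hx hqpos.le
    · exact hlim.mono fun x hx => hpow hqpos (by simpa only [enorm_zero] using hx.enorm)
  simpa only [eLpNorm_eq_lintegral_rpow_enorm_toReal hq0 hq] using
    hpow (one_div_pos.2 hqpos) hint

theorem memLp_top_of_ae_enorm_le {f : X → E} (hfm : AEStronglyMeasurable f μ)
    {C : ℝ≥0} (hf : ∀ᵐ x ∂μ, ‖f x‖ₑ ≤ C) : MemLp f ∞ μ :=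
  memLp_top_of_bound hfm C (hf.mono fun _ hx => by exact_mod_cast hx)

theorem memLp_top_of_ae_enorm_sq_le {f : X → E} (hfm : AEStronglyMeasurable f μ)
    {C : ℝ≥0} (hf : ∀ᵐ x ∂μ, ‖f x‖ₑ ^ 2 ≤ C) : MemLp f ∞ μ := by
  refine memLp_top_of_ae_enorm_le (C := NNReal.sqrt C) hfm (hf.mono fun x hx => ?_)
  rwa [← ENNReal.pow_le_pow_left_iff two_ne_zero, ← ENNReal.coe_pow, NNReal.sq_sqrt]

theorem memLp_top_tsum [CompleteSpace E] [Countable σ] {c : σ → X → E} {K : ℝ≥0}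
    (hcm : ∀ l, AEStronglyMeasurable (c l) μ) (hc : ∀ᵐ x ∂μ, ∑' l, ‖c l x‖ₑ ≤ K) :
    MemLp (fun x => ∑' l, c l x) ∞ μ := by
  have hmeas : AEStronglyMeasurable (fun x => ∑' l, c l x) μ := by
    refine aestronglyMeasurable_of_tendsto_ae (atTop : Filter (Finset σ))
      (fun L => Finset.aestronglyMeasurable_fun_sum L fun l _ => hcm l) ?_
    filter_upwards [hc] with x hx
    exact (Summable.of_enorm (hx.trans_lt ENNReal.coe_lt_top).ne).hasSum
  exact memLp_top_of_ae_enorm_le hmeas (hc.mono fun _ => enorm_tsum_le_tsum_enorm.trans)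

theorem tendsto_eLpNorm_sum_mul_sub_tsum_mul {𝕜 : Type*} [NormedField 𝕜] [CompleteSpace 𝕜]
    [Countable σ] {c : σ → X → 𝕜} {K : ℝ≥0} (hcm : ∀ l, AEStronglyMeasurable (c l) μ)
    (hc : ∀ᵐ x ∂μ, ∑' l, ‖c l x‖ₑ ≤ K) {q : ℝ≥0∞} (hq0 : q ≠ 0) (hq : q ≠ ∞) {f : X → 𝕜}
    (hf : MemLp f q μ) :
    Tendsto (fun L : Finset σ => eLpNorm
      ((fun x => ∑ l ∈ L, c l x * f x) - fun x => (∑' l, c l x) * f x) q μ) atTop (𝓝 0) := by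
  refine tendsto_eLpNorm_zero_of_dominated (G := fun x => (K + K : ℝ≥0) * ‖f x‖ₑ) hq0 hq
    (fun L => (Finset.aestronglyMeasurable_fun_sum L fun l _ => (hcm l).mul hf.1).sub
      ((memLp_top_tsum hcm hc).1.mul hf.1)) (fun L => ?_) ?_ ?_
  · filter_upwards [hc] with x hx
    rw [Pi.sub_apply, ← Finset.sum_mul, ← sub_mul, enorm_mul, ENNReal.coe_add]
    gcongr
    refine enorm_sub_le.trans (add_le_add ?_ (enorm_tsum_le_tsum_enorm.trans hx))
    exact (enorm_sum_le L fun l => c l x).trans ((ENNReal.sum_le_tsum L).trans hx)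
  · simp only [ENNReal.mul_rpow_of_nonneg _ _ (ENNReal.toReal_nonneg (a := q))]
    rw [lintegral_const_mul'' _ (hf.1.enorm.pow_const _)]
    exact ENNReal.mul_ne_top (by finiteness)
      (lintegral_rpow_enorm_lt_top_of_eLpNorm_lt_top hq0 hq hf.2).ne
  · filter_upwards [hc] with x hx
    have hsum : HasSum (fun l => c l x) (∑' l, c l x) :=
      (Summable.of_enorm (hx.trans_lt ENNReal.coe_lt_top).ne).hasSum
    simpa only [Pi.sub_apply, sub_self, SummationFilter.unconditional_filter] using
      (hsum.mul_right (f x)).sub_const ((∑' l, c l x) * f x)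

end BoundedSeries

section TensorSeries

variable {σ : Type*}

theorem flat_pos {p : ℝ} (hp : 0 < p) (hp2 : p < 2) : 0 < flat p :=
  div_pos (by linarith) (by linarith)

theorem exists_mul_eq_enorm_sq_eq {X 𝕜 : Type*} [RCLike 𝕜] {mX : MeasurableSpace X}
    {μ : Measure X} {a : X → 𝕜} (ha : AEStronglyMeasurable a μ) :
    ∃ u v : X → 𝕜, AEStronglyMeasurable u μ ∧ AEStronglyMeasurable v μ ∧
      ∀ x, u x * v x = a x ∧ ‖u x‖ₑ ^ 2 = ‖a x‖ₑ ∧ ‖v x‖ₑ ^ 2 = ‖a x‖ₑ := by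
  let v : X → 𝕜 := fun x => (√‖a x‖ : ℝ)
  have hvm : AEStronglyMeasurable v μ :=
    RCLike.continuous_ofReal.comp_aestronglyMeasurable
      (Real.continuous_sqrt.comp_aestronglyMeasurable ha.norm)
  have hv : ∀ x, ‖v x‖ ^ 2 = ‖a x‖ := fun x => by
    rw [RCLike.norm_ofReal, abs_of_nonneg (Real.sqrt_nonneg _), Real.sq_sqrt (norm_nonneg _)]
  have hv0 : ∀ x, v x = 0 → a x = 0 := fun x hx => by
    simpa [hx] using (hv x).symm
  have hu : ∀ x, ‖a x / v x‖ ^ 2 = ‖a x‖ := fun x => by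
    rw [norm_div, div_pow, hv, sq, mul_self_div_self]
  have enorm_sq : ∀ {y z : 𝕜}, ‖y‖ ^ 2 = ‖z‖ → ‖y‖ₑ ^ 2 = ‖z‖ₑ := fun {y z} h => by
    rw [← ofReal_norm, ← ofReal_norm, ← ENNReal.ofReal_pow (norm_nonneg _), h]
  exact ⟨fun x => a x / v x, v, (ha.aemeasurable.div hvm.aemeasurable).aestronglyMeasurable, hvm,
    fun x => ⟨div_mul_cancel_of_imp (hv0 x), enorm_sq (hu x), enorm_sq (hv x)⟩⟩

variable {a b : σ → ℝ → ℂ} {W D : ℝ≥0}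

theorem ae_tsum_enorm_tensor_le (ha : ∀ᵐ t, ∑' l, ‖a l t‖ₑ ≤ W)
    (hb : ∀ᵐ s, ∀ l, ‖b l s‖ₑ ≤ D) :
    ∀ᵐ z : ℝ × ℝ, ∑' l, ‖a l z.1 * b l z.2‖ₑ ≤ (W * D : ℝ≥0) := by
  have ha' : ∀ᵐ z : ℝ × ℝ ∂volume.prod volume, ∑' l, ‖a l z.1‖ₑ ≤ W :=
    Measure.quasiMeasurePreserving_fst.ae ha
  have hb' : ∀ᵐ z : ℝ × ℝ ∂volume.prod volume, ∀ l, ‖b l z.2‖ₑ ≤ D :=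
    Measure.quasiMeasurePreserving_snd.ae hb
  filter_upwards [ha', hb'] with z haz hbz
  calc ∑' l, ‖a l z.1 * b l z.2‖ₑ
      ≤ ∑' l, ‖a l z.1‖ₑ * D := by
        simp only [enorm_mul]
        exact ENNReal.tsum_le_tsum fun l => mul_le_mul_right (hbz l) _
    _ ≤ (W * D : ℝ≥0) := by
        rw [ENNReal.tsum_mul_right, ENNReal.coe_mul]
        exact mul_le_mul_left haz _

theorem schattenNorm_integralOp_sum_tensor_le {p : ℝ} (hp : 0 < p) (hp2 : p < 2)
    (ham : ∀ l, AEStronglyMeasurable (a l) volume) (ha : ∀ᵐ t, ∑' l, ‖a l t‖ₑ ≤ W)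
    (hb : ∀ l, MemLp (b l) ∞ volume) {f : ℝ × ℝ → ℂ} (hf : MemLp f 2 volume)
    (hfp : schattenNorm p (integralOp f hf) ≠ ∞)
    (h : ∀ l, MemLp (fun z : ℝ × ℝ => a l z.1 * b l z.2 * f z) 2 volume) (L : Finset σ) :
    schattenNorm p (integralOp (fun z => ∑ l ∈ L, a l z.1 * b l z.2 * f z)
      (memLp_finsetSum L fun l _ => h l)) ≤
      W * (∑ l ∈ L, eLpNorm (b l) ∞ volume ^ flat p) ^ (1 / flat p) *
        schattenNorm p (integralOp f hf) := by
  choose u v hum hvm huv husq hvsq using fun l => exists_mul_eq_enorm_sq_eq (ham l)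
  have memLp_factor : ∀ {w : σ → ℝ → ℂ}, (∀ l, AEStronglyMeasurable (w l) volume) →
      (∀ l t, ‖w l t‖ₑ ^ 2 = ‖a l t‖ₑ) → ∀ l, MemLp (w l) ∞ volume := fun hwm hwsq l =>
    memLp_top_of_ae_enorm_sq_le (hwm l) (ha.mono fun t ht =>
      (hwsq l t).trans_le ((ENNReal.le_tsum l).trans ht))
  have sum_sq_le : ∀ {w : σ → ℝ → ℂ} (hw : ∀ l, MemLp (w l) ∞ volume),
      (∀ l t, ‖w l t‖ₑ ^ 2 = ‖a l t‖ₑ) →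
      ∀ g, ∑ l ∈ L, ‖mulOp (w l) (hw l) g‖ₑ ^ 2 ≤ W * ‖g‖ₑ ^ 2 := fun {w} hw hwsq =>
    sum_enorm_mulOp_sq_le L hw (ha.mono fun t ht => by
      simpa only [hwsq] using (ENNReal.sum_le_tsum L).trans ht)
  have hu := memLp_factor hum husq
  have hv := memLp_factor hvm hvsq
  have hop : integralOp (fun z => ∑ l ∈ L, a l z.1 * b l z.2 * f z)
      (memLp_finsetSum L fun l _ => h l) =
      ∑ l ∈ L, mulOp (b l) (hb l) ∘L (integralOp f hf ∘L mulOp (u l) (hu l)) ∘L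
        mulOp (v l) (hv l) := by
    rw [integralOp_sum L h]
    refine Finset.sum_congr rfl fun l _ => ?_
    simp only [← huv]
    exact integralOp_mul_tensor hf (hu l) (hv l) (hb l) _
  have hS : ∀ g, ∑ l ∈ L, ‖adjoint (mulOp (u l) (hu l)) g‖ₑ ^ 2 ≤ W * ‖g‖ₑ ^ 2 := by
    simp only [adjoint_mulOp]
    exact sum_sq_le (fun l => (hu l).star) fun l t => by
      rw [Pi.star_apply, enorm_eq_iff_norm_eq.2 (norm_star (u l t)), husq]
  rw [hop]
  calc _ ≤ (W * W : ℝ≥0∞) ^ (1 / 2 : ℝ) *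
        (∑ l ∈ L, ‖mulOp (b l) (hb l)‖ₑ ^ flat p) ^ (1 / flat p) *
        schattenNorm p (integralOp f hf) :=
        schattenNorm_sum_comp_le hp hp2 hfp hS (sum_sq_le hv hvsq) _
    _ ≤ W * (∑ l ∈ L, eLpNorm (b l) ∞ volume ^ flat p) ^ (1 / flat p) *
        schattenNorm p (integralOp f hf) := by
      have hflat := flat_pos hp hp2
      rw [← sq, ← ENNReal.rpow_two, ← ENNReal.rpow_mul, mul_one_div_cancel two_ne_zero,
        ENNReal.rpow_one]
      gcongr
      exact enorm_mulOp_le (hb _)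

theorem multiplierNorm_tsum_tensor_le [Countable σ] {p : ℝ} (hp : 0 < p) (hp2 : p < 2)
    (ham : ∀ l, AEStronglyMeasurable (a l) volume) (ha : ∀ᵐ t, ∑' l, ‖a l t‖ₑ ≤ W)
    (hbm : ∀ l, AEStronglyMeasurable (b l) volume) (hb : ∀ᵐ s, ∀ l, ‖b l s‖ₑ ≤ D)
    (hK : MemLp (fun z : ℝ × ℝ => ∑' l, a l z.1 * b l z.2) ∞ volume) :
    multiplierNorm p (fun z : ℝ × ℝ => ∑' l, a l z.1 * b l z.2) hK ≤
      W * (∑' l, eLpNorm (b l) ∞ volume ^ flat p) ^ (1 / flat p) := by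
  refine iSup_le fun f => iSup_le fun hf => iSup_le fun hle => ?_
  have hflat := flat_pos hp hp2
  have hcm : ∀ l, AEStronglyMeasurable (fun z : ℝ × ℝ => a l z.1 * b l z.2) volume := fun l =>
    (ham l).comp_fst.mul (hbm l).comp_snd
  have hc := ae_tsum_enorm_tensor_le ha hb
  have hcf : ∀ l, MemLp (fun z : ℝ × ℝ => a l z.1 * b l z.2 * f z) 2 volume := fun l =>
    hf.mul' (memLp_top_of_ae_enorm_le (hcm l) (hc.mono fun z hz => (ENNReal.le_tsum l).trans hz))
  have hbL : ∀ l, MemLp (b l) ∞ volume := fun l =>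
    memLp_top_of_ae_enorm_le (hbm l) (hb.mono fun s hs => hs l)
  have hpartial : Tendsto (fun L : Finset σ => integralOp _ (memLp_finsetSum L fun l _ => hcf l))
      atTop (𝓝 (integralOp _ (hf.mul' hK))) := by
    refine tendsto_iff_edist_tendsto_0.2 <| tendsto_of_tendsto_of_tendsto_of_le_of_le
      tendsto_const_nhds (tendsto_eLpNorm_sum_mul_sub_tsum_mul hcm hc two_ne_zero
        ENNReal.ofNat_ne_top hf) (fun _ => zero_le) fun L => ?_
    simp only [edist_eq_enorm_sub, ← integralOp_sub]
    exact enorm_integralOp_le _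
  refine ((lowerSemicontinuous_schattenNorm hp).isClosed_preimage _).mem_of_tendsto hpartial
    (.of_forall fun L => ?_)
  calc schattenNorm p (integralOp _ (memLp_finsetSum L fun l _ => hcf l))
      ≤ W * (∑ l ∈ L, eLpNorm (b l) ∞ volume ^ flat p) ^ (1 / flat p) *
          schattenNorm p (integralOp f hf) :=
        schattenNorm_integralOp_sum_tensor_le hp hp2 ham ha hbL hf
          (hle.trans_lt ENNReal.one_lt_top).ne hcf L
    _ ≤ W * (∑' l, eLpNorm (b l) ∞ volume ^ flat p) ^ (1 / flat p) := by
        refine (mul_le_of_le_one_right' hle).trans ?_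
        gcongr
        exact ENNReal.sum_le_tsum L

end TensorSeries

section Wavelet

theorem exists_ae_tsum_enorm_comp_sub_le {E : Type*} [NormedAddCommGroup E] {φ : ℝ → E}
    (hφ : MemLp φ ∞ volume) (hφc : HasCompactSupport φ) :
    ∃ W : ℝ≥0, ∀ᵐ x, ∑' l : ℤ, ‖φ (x - l)‖ₑ ≤ W := by
  obtain ⟨r, hr⟩ := hφc.isCompact.isBounded.exists_norm_le
  have hzero : ∀ x (l : ℤ), l ∉ Finset.Icc ⌈x - r⌉ ⌊x + r⌋ → ‖φ (x - l)‖ₑ = 0 := fun x l hl => by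
    rw [enorm_eq_zero]
    refine image_eq_zero_of_notMem_tsupport fun hmem => hl ?_
    obtain ⟨hlow, hupp⟩ := abs_le.1 (hr _ hmem)
    exact Finset.mem_Icc.2 ⟨Int.ceil_le.2 (by linarith), Int.le_floor.2 (by linarith)⟩
  have hcard : ∀ x : ℝ, (Finset.Icc ⌈x - r⌉ ⌊x + r⌋).card ≤ ⌈2 * r + 1⌉₊ := fun x => by
    rw [Int.card_Icc, Int.toNat_le]
    have h : ((⌊x + r⌋ + 1 - ⌈x - r⌉ : ℤ) : ℝ) ≤ ⌈2 * r + 1⌉₊ := by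
      push_cast
      linarith [Int.floor_le (x + r), Int.le_ceil (x - r), Nat.le_ceil (2 * r + 1)]
    exact_mod_cast h
  have hφM : ∀ᵐ x, ‖φ x‖ₑ ≤ eLpNorm φ ∞ volume := enorm_ae_le_eLpNormEssSup φ volume
  lift eLpNorm φ ∞ volume to ℝ≥0 using hφ.2.ne with M
  have hbound : ∀ᵐ x, ∀ l : ℤ, ‖φ (x - l)‖ₑ ≤ M := ae_all_iff.2 fun l =>
    (measurePreserving_sub_right volume (l : ℝ)).quasiMeasurePreserving.ae hφM
  refine ⟨⌈2 * r + 1⌉₊ * M, ?_⟩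
  filter_upwards [hbound] with x hx
  rw [tsum_eq_sum (hzero x)]
  refine (Finset.sum_le_card_nsmul _ _ _ fun l _ => hx l).trans ?_
  rw [nsmul_eq_mul]
  push_cast
  gcongr
  exact_mod_cast hcard x

variable {φ : ℝ → ℂ}

theorem tsum_enorm_waveletFun (j : ℤ) (t : ℝ) :
    ∑' l, ‖waveletFun φ j l t‖ₑ = 2 ^ ((j : ℝ) / 2) * ∑' l : ℤ, ‖φ (2 ^ j * t - l)‖ₑ := by
  have hscale : ‖(((2 : ℝ) ^ ((j : ℝ) / 2) : ℝ) : ℂ)‖ₑ = 2 ^ ((j : ℝ) / 2) := by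
    rw [← ofReal_norm, Complex.norm_real, Real.norm_of_nonneg (by positivity),
      ← ENNReal.ofReal_rpow_of_pos two_pos, ENNReal.ofReal_ofNat]
  simp only [waveletFun, enorm_mul, hscale, ENNReal.tsum_mul_left]

theorem ae_tsum_enorm_waveletFun_le {W : ℝ≥0} (hW : ∀ᵐ x, ∑' l : ℤ, ‖φ (x - l)‖ₑ ≤ W) (j : ℤ) :
    ∀ᵐ t, ∑' l, ‖waveletFun φ j l t‖ₑ ≤ (W * 2 ^ ((j : ℝ) / 2) : ℝ≥0) := by
  have hj : (2 : ℝ) ^ j ≠ 0 := by positivity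
  have hdil : Measure.QuasiMeasurePreserving ((2 : ℝ) ^ j * ·) volume volume :=
    ⟨measurable_const_mul _, by
      rw [Real.map_volume_mul_left hj]
      exact Measure.smul_absolutelyContinuous⟩
  filter_upwards [hdil.ae hW] with t ht
  rw [tsum_enorm_waveletFun, mul_comm, ENNReal.coe_mul, ENNReal.coe_rpow_of_ne_zero two_ne_zero]
  exact mul_le_mul_left ht _

theorem integrable_waveletFun (hφ : Integrable φ) (j l : ℤ) : Integrable (waveletFun φ j l) :=
  ((hφ.comp_sub_right (l : ℝ)).comp_mul_left' (by positivity)).const_mul _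

theorem lintegral_enorm_waveletFun (j l : ℤ) :
    ∫⁻ t, ‖waveletFun φ j l t‖ₑ = ∫⁻ t, ‖waveletFun φ j 0 t‖ₑ := by
  have hj : (2 : ℝ) ^ j ≠ 0 := by positivity
  rw [← lintegral_sub_right_eq_self (fun t => ‖waveletFun φ j 0 t‖ₑ) (l / (2 : ℝ) ^ j)]
  simp only [waveletFun, mul_sub, mul_div_cancel₀ _ hj, Int.cast_zero, sub_zero]

theorem aestronglyMeasurable_waveletCoeff (hφ : Integrable φ) {k : ℝ × ℝ → ℂ}
    (hk : AEStronglyMeasurable k volume) (j l : ℤ) :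
    AEStronglyMeasurable (waveletCoeff φ k j l) volume := by
  have hkswap : AEStronglyMeasurable (fun z : ℝ × ℝ => k z.swap) (volume.prod volume) :=
    hk.prod_swap
  exact ((integrable_waveletFun hφ j l).1.comp_snd.mul hkswap).integral_prod_right'

theorem ae_enorm_waveletCoeff_le {k : ℝ × ℝ → ℂ} (hk : eLpNorm k ∞ volume ≠ ∞) (j : ℤ) :
    ∀ᵐ s, ∀ l, ‖waveletCoeff φ k j l s‖ₑ ≤
      (∫⁻ t, ‖waveletFun φ j 0 t‖ₑ) * eLpNorm k ∞ volume := by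
  have hkswap : ∀ᵐ z : ℝ × ℝ ∂volume.prod volume, ‖k z.swap‖ₑ ≤ eLpNorm k ∞ volume :=
    (Measure.measurePreserving_swap (μ := volume) (ν := volume)).quasiMeasurePreserving.ae
      (enorm_ae_le_eLpNormEssSup k volume)
  filter_upwards [Measure.ae_ae_of_ae_prod hkswap] with s hs l
  calc ‖waveletCoeff φ k j l s‖ₑ
      ≤ ∫⁻ t, ‖waveletFun φ j l t * k (t, s)‖ₑ := enorm_integral_le_lintegral_enorm _
    _ ≤ ∫⁻ t, ‖waveletFun φ j l t‖ₑ * eLpNorm k ∞ volume := by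
        refine lintegral_mono_ae (hs.mono fun t ht => ?_)
        rw [enorm_mul]
        exact mul_le_mul_right ht _
    _ = (∫⁻ t, ‖waveletFun φ j 0 t‖ₑ) * eLpNorm k ∞ volume := by
        rw [lintegral_mul_const' _ _ hk, lintegral_enorm_waveletFun]

end Wavelet

end SchurWavelet

open SchurWavelet in
theorem mainTheorem6_general (φ : ℝ → ℂ) (hφ : MemLp φ ∞ volume) (hφc : HasCompactSupport φ) :
    ∃ C : ℝ≥0, ∀ (p : ℝ), 0 < p → p < 2 →
      ∀ (k : ℝ × ℝ → ℂ), MemLp k ∞ volume → ∀ (j : ℤ),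
        ∃ hkj : MemLp (SchurWavelet.scalePart φ k j) ∞ volume,
          SchurWavelet.multiplierNorm p (SchurWavelet.scalePart φ k j) hkj ≤
            (C : ℝ≥0∞) * (2 : ℝ≥0∞) ^ ((j : ℝ) / 2) *
              SchurWavelet.ellNorm (SchurWavelet.flat p)
                (fun l : ℤ => eLpNorm (SchurWavelet.waveletCoeff φ k j l) ∞ volume) := by
  obtain ⟨W, hW⟩ := exists_ae_tsum_enorm_comp_sub_le hφ hφc
  refine ⟨W, fun p hp hp2 k hk j => ?_⟩
  have hφ1 : Integrable φ := memLp_one_iff_integrable.1 <|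
    hφ.mono_exponent_of_measure_support_ne_top (fun _ => image_eq_zero_of_notMem_tsupport)
      hφc.isCompact.measure_lt_top.ne le_top
  have ham := fun l => (integrable_waveletFun hφ1 j l).1
  have ha := ae_tsum_enorm_waveletFun_le hW j
  have hbm := aestronglyMeasurable_waveletCoeff hφ1 hk.1 j
  have hb := ae_enorm_waveletCoeff_le (φ := φ) hk.2.ne j
  lift (∫⁻ t, ‖waveletFun φ j 0 t‖ₑ) * eLpNorm k ∞ volume to ℝ≥0
    using ENNReal.mul_ne_top (integrable_waveletFun hφ1 j 0).2.ne hk.2.ne with D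
  have hkj : MemLp (scalePart φ k j) ∞ volume :=
    memLp_top_tsum (fun l => (ham l).comp_fst.mul (hbm l).comp_snd) (ae_tsum_enorm_tensor_le ha hb)
  refine ⟨hkj, (multiplierNorm_tsum_tensor_le hp hp2 ham ha hbm hb hkj).trans_eq ?_⟩
  rw [ENNReal.coe_mul, ENNReal.coe_rpow_of_ne_zero two_ne_zero, ENNReal.coe_ofNat, ellNorm]

theorem mainTheorem6 (φ : ℝ → ℂ) (hφ : MemLp φ ∞ volume) (hφc : HasCompactSupport φ)
    (hφw : SchurWavelet.IsOrthonormalWavelet φ) :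
    ∃ C : ℝ≥0, ∀ (p : ℝ), 0 < p → p < 2 →
      ∀ (k : ℝ × ℝ → ℂ), MemLp k ∞ volume → ∀ (j : ℤ),
        ∃ hkj : MemLp (SchurWavelet.scalePart φ k j) ∞ volume,
          SchurWavelet.multiplierNorm p (SchurWavelet.scalePart φ k j) hkj ≤
            (C : ℝ≥0∞) * (2 : ℝ≥0∞) ^ ((j : ℝ) / 2) *
              SchurWavelet.ellNorm (SchurWavelet.flat p)
                (fun l : ℤ => eLpNorm (SchurWavelet.waveletCoeff φ k j l) ∞ volume) :=
  mainTheorem6_general φ hφ hφc
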